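/- Let $V=\bigoplus_{n\in\mathbb Z}V_n$ be a graded vector space over a field of characteristic $0$, with a homogeneous basis $\{e_a\}$, and let $\mu_{k,p}:\odot^kV\otimes\wedge^pV\to V[1-p]$ ($k\ge1$, $p\ge0$) be a collection of linear maps (of degree $1-p$, graded symmetric in the first $k$ and graded antisymmetric in the last $p$ arguments). The collection is a **pre-Lie$^2_\infty$ structure** on $V$ if for all homogeneous $v=(v_1,\dots,v_k)$, $w=(w_1,\dots,w_p)$ $$\sum_{v=I_1\sqcup I_2,\ w=J_1\sqcup J_2,\ \#I_2\ge1}\pm(-1)^{\#J_2+\sigma(J_1\sqcup J_2)}\mu(I_1,\mu(I_2;J_1);J_2)\;-\sum_{\substack{v=I_1\sqcup I_2,\ w=J_1\sqcup J_2\sqcup J_3\\ \#I_1\ge1,\ \#J_1=1}}\pm(-1)^{\#J_2+\#J_3+\sigma(J_1\sqcup J_2\sqcup J_3)}\mu(I_1;\mu(I_2,J_1;J_2),J_3)=0,$$ where $\sigma$ is the parity of the permutation of $w$ and $\pm$ is the Koszul sign of permuting the arguments and of moving the inner operation past $I_1$. (The terms containing $\mu_{1,0}$ are those of the differential $-\mu_{1,0}$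 of $V$.) Let $t^a$, $|t^a|=-|e_a|$, be the dual coordinates on the formal neighbourhood $\hat V$ of $0$ in $V$, let $|dt^a|=1-|e_a|$, with all $t^a$, $dt^a$ graded commuting, and put $$\Gamma_p=\sum_{k\ge1}\frac1{k!\,p!}(-1)^{\epsilon}\,t^{\alpha_1}\cdots t^{\alpha_k}\,\mu_{\alpha_1\dots\alpha_k,\beta_1\dots\beta_p}^{\ \gamma}\ \frac{\partial}{\partial t^\gamma}\otimes dt^{\beta_1}\wedge\dots\wedge dt^{\beta_p},$$ $$\epsilon=\sum_{i=1}^k|e_{\alpha_i}|\Bigl(2-p+\sum_{j=1}^{i}|e_{\alpha_j}|\Bigr)+\sum_{i=1}^p(|e_{\beta_i}|+1)\sum_{j=i+1}^p|e_{\beta_j}|,$$ where $\mu_{k,p}(e_{\alpha_1},\dots,e_{\alpha_k};e_{\beta_1},\dots,e_{\beta_p})=\sum_\gamma\mu_{\alpha_1\dots\alpha_k,\beta_1\dots\beta_p}^{\ \gamma}e_\gamma$. Let $\eth=\Gamma_0$, a vector field of degree $1$ on $\hat V$, and $\Gamma=\sum_{p\ge1}\Gamma_p$, a tangent-vector-valued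 differential form of total degree $1$. Then the collection $\{\mu_{k,p}\}$ is a pre-Lie$^2_\infty$ structure on $V$ if and only if $$[\eth,\eth]=0\qquad\text{and}\qquad \mathrm{Lie}_\eth\Gamma+\tfrac12[\Gamma\bullet\Gamma]=0,$$ where $\mathrm{Lie}_\eth$ is the Lie derivative along $\eth$ and $[\,\bullet\,]$ is the Frölicher–Nijenhuis bracket. In particular, if $V$ is concentrated in degree $0$, then $\eth=0$, $\Gamma=\Gamma_1$, and the collection is a pre-Lie$^2_\infty$ structure if and only if $[\Gamma_1\bullet\Gamma_1]=0$; if moreover $V$ is finite dimensional, this holds if and only if the Nijenhuis tensor $N_J(X,Y)=[JX,JY]+J^2[X,Y]-J[X,JY]-J[JX,Y]$ of the endomorphism $J=\Gamma_1$ of the tangent bundle of $\hat V$ vanishes for all formal vector fields $X,Y$. -/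

import Mathlib

open scoped BigOperators

namespace PreLieSq

/-! ### Signs and unshuffles -/

/-- The sign `(-1)^n` as a scalar. -/
def sgn (K : Type*) [Field K] (n : ℤ) : K := ((Int.negOnePow n : ℤˣ) : ℤ)

/-- All ways to split a word into two complementary subwords, `l = l₁ ⊔ l₂`. The third entry is the
exponent of the sign of the rearrangement `l → l₁ l₂`, where interchanging two neighbouring letters
`a b → b a` costs `(-1)^(e a b)`. -/
def unshuffles {X : Type*} (e : X → X → ℤ) : List X → List (List X × List X × ℤ)
  | [] => [([], [], 0)]
  | a :: l => (unshuffles e l).flatMap fun s =>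
      [(a :: s.1, s.2.1, s.2.2),
       (s.1, a :: s.2.1, s.2.2 + (s.1.map fun b => e a b).sum)]

/-- Total degree of a word. -/
def totalDeg {X : Type*} (deg : X → ℤ) (l : List X) : ℤ := (l.map deg).sum

/-- Exponent of the Koszul sign of letters that commute in the graded sense. -/
def symExp {X : Type*} (deg : X → ℤ) (a b : X) : ℤ := deg a * deg b

/-- Exponent of the Koszul sign of letters that anticommute in the graded sense. -/
def skewExp {X : Type*} (deg : X → ℤ) (a b : X) : ℤ := deg a * deg b + 1

/-! ### Collections of operations and the quadratic equations -/

section Algebra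

variable {K V : Type*} [Field K] [AddCommGroup V] [Module K V]

/-- A homogeneous element of the graded vector space `V = ⨁ 𝒱 n`, with its degree. -/
abbrev Homog (𝒱 : ℤ → Submodule K V) := Σ n : ℤ, 𝒱 n

/-- The degree of a homogeneous element. -/
def Homog.deg {𝒱 : ℤ → Submodule K V} (x : Homog 𝒱) : ℤ := x.1

/-- The words of vectors underlying a word of homogeneous elements. -/
def vecs {𝒱 : ℤ → Submodule K V} (l : List (Homog 𝒱)) : List V := l.map fun x => (x.2 : V)

/-- The value `μ_{k,p}(v₁, …, v_k ; w₁, …, w_p)`, where `k` and `p` are the lengths of the words. -/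
def evalOp (μ : (k p : ℕ) → MultilinearMap K (fun _ : Fin k ⊕ Fin p => V) V) (v w : List V) : V :=
  μ v.length w.length (Sum.elim v.get w.get)

/-- A collection of linear maps `μ_{k,p} : ⊙^k V ⊗ ⋀^p V → V[1-p]`, `k ≥ 1`, `p ≥ 0`: multilinear
maps of degree `1 - p`, graded symmetric in the first `k` arguments and graded antisymmetric in the
last `p` ones. There is no operation with `k = 0`, which is recorded as `μ_{0,p} = 0`. -/
structure Operations (𝒱 : ℤ → Submodule K V) where
  /-- the multilinear maps -/
  μ : (k p : ℕ) → MultilinearMap K (fun _ : Fin k ⊕ Fin p => V) V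
  zero_left : ∀ p, μ 0 p = 0
  degree : ∀ v w : List (Homog 𝒱), evalOp μ (vecs v) (vecs w) ∈
    𝒱 (totalDeg Homog.deg v + totalDeg Homog.deg w + 1 - w.length)
  symm : ∀ (v v' w : List (Homog 𝒱)) (x y : Homog 𝒱),
    evalOp μ (vecs (v ++ x :: y :: v')) (vecs w) =
      sgn K (symExp Homog.deg x y) • evalOp μ (vecs (v ++ y :: x :: v')) (vecs w)
  skew : ∀ (v w w' : List (Homog 𝒱)) (x y : Homog 𝒱),
    evalOp μ (vecs v) (vecs (w ++ x :: y :: w')) =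
      sgn K (skewExp Homog.deg x y) • evalOp μ (vecs v) (vecs (w ++ y :: x :: w'))

namespace Operations

variable {𝒱 : ℤ → Submodule K V} (m : Operations 𝒱)

/-- The part of the quadratic relation in which the value of the inner operation is a symmetric
argument of the outer one: the sum over `v = v₁ ⊔ v₂`, `w = w₁ ⊔ w₂` of
`± μ(v₁, μ(v₂ ; w₁) ; w₂)`. The sign is `(-1)^#w₂`, times the sign of the permutations, times the
Koszul sign of moving the inner operation, of degree `1 - #w₁`, past `v₁`.
Terms with `v₂` empty vanish. -/
def relSymm (v w : List (Homog 𝒱)) : V :=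
  ((unshuffles (symExp Homog.deg) v).map fun s =>
    ((unshuffles (skewExp Homog.deg) w).map fun r =>
      sgn K (r.2.1.length + s.2.2 + r.2.2 + (1 - r.1.length) * totalDeg Homog.deg s.1) •
        evalOp m.μ (vecs s.1 ++ [evalOp m.μ (vecs s.2.1) (vecs r.1)]) (vecs r.2.1)).sum).sum

/-- The part of the quadratic relation in which the value of the inner operation is an antisymmetric
argument of the outer one: the sum over `v = v₁ ⊔ v₂`, `w = w₁ ⊔ w₂ ⊔ w₃`, with `w₁` a single
letter, of `± μ(v₁ ; μ(v₂, w₁ ; w₂), w₃)`. The sign is `(-1)^(#w₂ + #w₃)`, times the sign of the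
permutations, times the Koszul sign of moving the inner operation, of degree `1 - #w₂`, past `v₁`.
Terms with `v₁` empty vanish. -/
def relSkew (v w : List (Homog 𝒱)) : V :=
  ((unshuffles (symExp Homog.deg) v).map fun s =>
    ((unshuffles (skewExp Homog.deg) w).map fun r =>
      (((unshuffles (skewExp Homog.deg) r.1).filter fun q => q.1.length = 1).map fun q =>
        sgn K (q.2.1.length + r.2.1.length + s.2.2 + r.2.2 + q.2.2
            + (1 - q.2.1.length) * totalDeg Homog.deg s.1) •
          evalOp m.μ (vecs s.1)
            (evalOp m.μ (vecs s.2.1 ++ vecs q.1) (vecs q.2.1) :: vecs r.2.1)).sum).sum).sum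

/-- The collection is a pre-Lie²_∞ structure: all the quadratic relations encoded by the
differential of the operad hold. The terms with `μ_{1,0}` are the ones that come from the
differential of the dg vector space `(V, -μ_{1,0})`. -/
def IsPreLieSqInfinity : Prop :=
  ∀ v w : List (Homog 𝒱), m.relSymm v w - m.relSkew v w = 0

end Operations

end Algebra

/-! ### Formal functions, differential forms and vector-valued forms

`ι` indexes a homogeneous basis `e_a` of `V`, `deg a = |e_a|`. The dual coordinates `t^a` have degree
`-deg a`, the differentials `dt^a` have degree `1 - deg a`, and all of them commute in the graded
sense with respect to these (total) degrees. -/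

section Geometry

variable {K ι : Type*} [Field K] (deg : ι → ℤ)

/-- A formal differential form
`f = ∑_{k,p} 1/(k! p!) ∑ f(a₁…a_k ; b₁…b_p) t^{a₁}⋯t^{a_k} dt^{b₁}⋯dt^{b_p}`
on the formal neighbourhood of `0` in `V`, given by its coefficients. The coefficients that arise
have the symmetry of the monomials, and so are determined by the form. -/
abbrev Form (K ι : Type*) := List ι → List ι → K

/-- A form of degree zero, i.e. a formal function: no `dt^b` occurs, and the coefficients have the
symmetry of the monomials `t^{a₁}⋯t^{a_k}`. -/
def IsFunction (f : Form K ι) : Prop :=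
  (∀ α β, β ≠ [] → f α β = 0) ∧
  ∀ (α α' : List ι) (a b : ι),
    f (α ++ a :: b :: α') [] = sgn K (deg a * deg b) * f (α ++ b :: a :: α') []

/-- The parity of `dt^a`. -/
def dtDeg (a : ι) : ℤ := deg a + 1

/-- The product of forms. The sign is that of the rearrangement of `t^α dt^β` into
`t^{α₁} dt^{β₁} t^{α₂} dt^{β₂}`. -/
def Form.mul (f g : Form K ι) : Form K ι := fun α β =>
  ((unshuffles (symExp deg) α).map fun s =>
    ((unshuffles (symExp (dtDeg deg)) β).map fun r =>
      sgn K (s.2.2 + r.2.2 + totalDeg (dtDeg deg) r.1 * totalDeg deg s.2.1) *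
        (f s.1 r.1 * g s.2.1 r.2.1)).sum).sum

open Classical in
/-- The coordinate function `t^a`. -/
noncomputable def coord (a : ι) : Form K ι := fun α β => if α = [a] ∧ β = [] then 1 else 0

open Classical in
/-- The one-form `dt^a`. -/
noncomputable def dcoord (a : ι) : Form K ι := fun α β => if α = [] ∧ β = [a] then 1 else 0

/-- The left derivative `∂f/∂t^a`. -/
def partialT (a : ι) (f : Form K ι) : Form K ι := fun α β => f (a :: α) β

/-- The left derivative `∂f/∂(dt^a)`; it passes the `t`'s that stand in front of the `dt`'s. -/
def partialDt (a : ι) (f : Form K ι) : Form K ι := fun α β =>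
  sgn K (dtDeg deg a * totalDeg deg α) * f α (a :: β)

/-- The de Rham differential `d = ∑_a dt^a ∂/∂t^a`. Each coefficient is a finite sum. -/
noncomputable def deRham (f : Form K ι) : Form K ι := fun α β =>
  ∑ᶠ a, Form.mul deg (dcoord a) (partialT a f) α β

/-- A vector-valued form `K = ∑_a K^a ∂/∂t^a`, given by its components, with the form-valued
coefficient on the left; a vector field is a vector-valued form whose components are functions. -/
abbrev VForm (K ι : Type*) := ι → Form K ι

/-- The action of a vector field on functions, `X f = ∑_a X^a ∂f/∂t^a`. -/
noncomputable def vfAct (X : VForm K ι) (f : Form K ι) : Form K ι := fun α β =>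
  ∑ᶠ a, Form.mul deg (X a) (partialT a f) α β

/-- The insertion operator `i_L = ∑_a L^a ∂/∂(dt^a)`, the algebraic derivation of the algebra of
forms that vanishes on functions and has `i_L(dt^a) = L^a`. It has degree `|L| - 1`. -/
noncomputable def insertion (L : VForm K ι) (f : Form K ι) : Form K ι := fun α β =>
  ∑ᶠ a, Form.mul deg (L a) (partialDt deg a f) α β

/-- The graded commutator `P Q - (-1)^{pq} Q P` of operators of degrees `p` and `q`. -/
def gradedComm (p q : ℤ) (P Q : Form K ι → Form K ι) (f : Form K ι) : Form K ι :=
  P (Q f) - sgn K (p * q) • Q (P f)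

/-- The Lie derivation `[i_L, d]` of the algebra of forms along a vector-valued form `L` of total
degree `l`. -/
noncomputable def lieDerivation (l : ℤ) (L : VForm K ι) : Form K ι → Form K ι :=
  gradedComm (l - 1) 1 (insertion deg L) (deRham deg)

/-- The Lie bracket of vector fields of degrees `x` and `y`: its component at `∂/∂t^c` is the value
of the graded commutator on `t^c`. -/
noncomputable def vfBracket (x y : ℤ) (X Y : VForm K ι) : VForm K ι := fun c =>
  gradedComm x y (vfAct deg X) (vfAct deg Y) (coord c)

/-- The Lie derivative of a vector-valued form `L` of total degree `l` along a vector field `X` of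
degree `x`, determined by `i_{Lie_X L} = [Lie_X, i_L]`: its component at `∂/∂t^c` is the value of
that commutator on `dt^c`. -/
noncomputable def lieDerivative (x l : ℤ) (X L : VForm K ι) : VForm K ι := fun c =>
  gradedComm x (l - 1) (lieDerivation deg x X) (insertion deg L) (dcoord c)

/-- The Frölicher–Nijenhuis bracket of vector-valued forms of total degrees `k` and `l`: the
commutator of the Lie derivations along `M` and `L` commutes with `d`, hence is the Lie derivation
along a unique vector-valued form `[M • L]`, whose component at `∂/∂t^c` is its value on `t^c`. -/
noncomputable def fnBracket (k l : ℤ) (M L : VForm K ι) : VForm K ι := fun c =>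
  gradedComm k l (lieDerivation deg k M) (lieDerivation deg l L) (coord c)

/-- The value `J(X)` of a vector-valued one-form `J`, i.e. an endomorphism of the tangent bundle, on
a vector field `X`, all of degree zero: `J(X)^c = i_X(J^c)`. -/
noncomputable def applyEnd (J X : VForm K ι) : VForm K ι := fun c => insertion deg X (J c)

/-- The Nijenhuis tensor `N_J(X,Y) = [JX,JY] + J²[X,Y] - J[X,JY] - J[JX,Y]` of an endomorphism of
the tangent bundle of a manifold that is concentrated in degree zero. -/
noncomputable def nijenhuis (J X Y : VForm K ι) : VForm K ι :=
  vfBracket deg 0 0 (applyEnd deg J X) (applyEnd deg J Y)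
    + applyEnd deg J (applyEnd deg J (vfBracket deg 0 0 X Y))
    - applyEnd deg J (vfBracket deg 0 0 X (applyEnd deg J Y))
    - applyEnd deg J (vfBracket deg 0 0 (applyEnd deg J X) Y)

/-! ### Assembling the operations -/

/-- The exponent `∑_i |e_{α_i}| (2 - p + ∑_{j ≤ i} |e_{α_j}|) + ∑_i (|e_{β_i}| + 1) ∑_{j > i} |e_{β_j}|`
with `p = #β`. -/
def epsilon (α β : List ι) : ℤ :=
  ∑ i : Fin α.length, deg (α.get i) * (2 - β.length + ∑ j ∈ Finset.Iic i, deg (α.get j))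
    + ∑ i : Fin β.length, (deg (β.get i) + 1) * ∑ j ∈ Finset.Ioi i, deg (β.get j)

variable {V : Type*} [AddCommGroup V] [Module K V] {𝒱 : ℤ → Submodule K V}

open Classical in
/-- The vector-valued `p`-form
`Γ_p = ∑_k 1/(k! p!) (-1)^ε t^{α₁}⋯t^{α_k} μ_{α,β}^c ∂/∂t^c ⊗ dt^{β₁}⋯dt^{β_p}`.
Writing the coefficient of `∂/∂t^c` (of degree `|e_c|`) on the left costs the sign
`(-1)^(|e_c| ∑ (|e_{β_i}| + 1))`. -/
noncomputable def gammaP (b : Module.Basis ι K V) (m : Operations 𝒱) (p : ℕ) : VForm K ι :=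
  fun c α β =>
    if β.length = p then
      sgn K (epsilon deg α β + deg c * totalDeg (dtDeg deg) β) *
        b.repr (evalOp m.μ (α.map b) (β.map b)) c
    else 0

/-- The vector field `ð` assembled from the operations `μ_{k,0}`. -/
noncomputable def eth (b : Module.Basis ι K V) (m : Operations 𝒱) : VForm K ι := gammaP deg b m 0

/-- The vector-valued form `Γ = ∑_{p ≥ 1} Γ_p`; each coefficient is a finite sum. -/
noncomputable def gamma (b : Module.Basis ι K V) (m : Operations 𝒱) : VForm K ι := fun c α β =>
  ∑ᶠ (p : ℕ) (_ : 1 ≤ p), gammaP deg b m p c α β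

end Geometry

end PreLieSq

/-! Put `Q = ð + Γ`, a vector-valued form of total degree 1 (`totalForm`). For any `L` of degree 1,
the terms of `i_L d` and `d i_L` that contain `d(∂f/∂(dt^a))` cancel, so the Lie derivation along
`L` is `f ↦ ∑ L^a ∂f/∂t^a - ∑ dL^a ∂f/∂(dt^a)` (`IsDegOne.lieDerivation_apply`). Applied to `Q^c`
with `L = Q`, this is half of the component at `c` of the bracket of `Q` with itself. Its part
without `dt`'s is half of `[ð,ð]`, and the rest is `Lie_ð Γ + ½[Γ•Γ]`, so the two structure
equations together say that it vanishes (`structure_equations_iff`).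

A product of forms is a sum over unshuffles of `α` and `β`, and the contraction over `a` composes
two operations. Hence the coefficient of `∑ Q^a ∂Q^c/∂t^a` at `(α, β)` is the component at `c` of
`relSymm` on basis vectors (`vfAct_totalForm`), and that of `∑ dQ^a ∂Q^c/∂(dt^a)` is the component
of `relSkew` (`insertionD_totalForm`). Both carry the same sign `(-1)^structExp`, which therefore
drops out. Multilinearity reduces the quadratic relations to basis vectors.

If `V` sits in degree 0, an operation of degree `1 - p` vanishes unless `p = 1`, so only `J = Γ_1`
remains. Formal functions then form a commutative ring with derivations `∂/∂t^a`. Over it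
`N_J(X,Y)^c = ∑ X^i Y^j N^c_{ij}` (`nijenhuis_eq_sum`), and the same `N^c_{ij}` are the coefficients
of half of `[J•J]^c` (`fnBracket_eq_zero_iff`). -/

namespace PreLieSq

/-! ### Signs and their dependence on exponents modulo 2 -/

section Signs

variable (K : Type*) [Field K]

lemma sgn_add (m n : ℤ) : sgn K (m + n) = sgn K m * sgn K n := by
  simp [sgn, Int.negOnePow_add]

@[simp] lemma sgn_zero : sgn K 0 = 1 := by simp [sgn]

@[simp] lemma sgn_one : sgn K 1 = -1 := by simp [sgn]

lemma sgn_mul_self (m : ℤ) : sgn K m * sgn K m = 1 := by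
  rw [← sgn_add, sgn, Int.negOnePow_even _ ⟨m, rfl⟩]; simp

lemma sgn_ne_zero (m : ℤ) : sgn K m ≠ 0 := fun h => by
  simpa [h] using sgn_mul_self K m

/-- Through this lemma sign comparisons can be made as polynomial identities over `ZMod 2`. -/
lemma sgn_congr {m n : ℤ} (h : (m : ZMod 2) = n) : sgn K m = sgn K n := by
  have h2 : Even (m - n) := by
    rw [← ZMod.intCast_eq_zero_iff_even]; simp [h]
  rw [sgn, sgn, (Int.negOnePow_eq_iff m n).2 h2]

end Signs

/-! ### Sums over unshuffles -/

section ShuffleSums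

variable {X Y M N : Type*} [AddCommMonoid M] [AddCommMonoid N]

/-- The sum of `F l₁ l₂ n` over the unshuffles `l = l₁ ⊔ l₂` with sign exponent `n`. -/
def shSum (e : X → X → ℤ) (l : List X) (F : List X → List X → ℤ → M) : M :=
  ((unshuffles e l).map fun s => F s.1 s.2.1 s.2.2).sum

@[simp] lemma shSum_nil (e : X → X → ℤ) (F : List X → List X → ℤ → M) :
    shSum e [] F = F [] [] 0 := by
  simp [shSum, unshuffles]

lemma shSum_cons (e : X → X → ℤ) (a : X) (l : List X) (F : List X → List X → ℤ → M) :
    shSum e (a :: l) F = shSum e l fun s t n =>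
      F (a :: s) t n + F s (a :: t) (n + (s.map (e a)).sum) := by
  simp only [shSum, unshuffles]
  induction unshuffles e l with
  | nil => simp
  | cons s L ih => simp [ih, add_assoc]

lemma shSum_add (e : X → X → ℤ) (l : List X) (F G : List X → List X → ℤ → M) :
    shSum e l (fun s t n => F s t n + G s t n) = shSum e l F + shSum e l G := by
  simp only [shSum]
  induction unshuffles e l with
  | nil => simp
  | cons s L ih => simp only [List.map_cons, List.sum_cons, ih]; abel

lemma shSum_cons' (e : X → X → ℤ) (a : X) (l : List X) (F : List X → List X → ℤ → M) :
    shSum e (a :: l) F = shSum e l (fun s t n => F (a :: s) t n) +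
      shSum e l (fun s t n => F s (a :: t) (n + (s.map (e a)).sum)) := by
  rw [shSum_cons, shSum_add]

lemma map_shSum (f : M →+ N) (e : X → X → ℤ) (l : List X) (F : List X → List X → ℤ → M) :
    f (shSum e l F) = shSum e l fun s t n => f (F s t n) := by
  simp [shSum, map_list_sum, Function.comp_def]

lemma mul_shSum {R : Type*} [NonUnitalNonAssocSemiring R] (c : R) (e : X → X → ℤ) (l : List X)
    (F : List X → List X → ℤ → R) :
    c * shSum e l F = shSum e l fun s t n => c * F s t n :=
  map_shSum (AddMonoidHom.mulLeft c) e l F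

lemma shSum_mul {R : Type*} [NonUnitalNonAssocSemiring R] (c : R) (e : X → X → ℤ) (l : List X)
    (F : List X → List X → ℤ → R) :
    shSum e l F * c = shSum e l fun s t n => F s t n * c :=
  map_shSum (AddMonoidHom.mulRight c) e l F

/-- Two sums over unshuffles agree if their terms agree along a relation between a word, the two
parts and the two exponents that is inherited by longer words. -/
lemma shSum_congr_of_rel {e e' : X → X → ℤ} (R : List X → List X → List X → ℤ → ℤ → Prop)
    (h0 : R [] [] [] 0 0)
    (h1 : ∀ a l s t n n', R l s t n n' → R (a :: l) (a :: s) t n n')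
    (h2 : ∀ a l s t n n', R l s t n n' →
      R (a :: l) s (a :: t) (n + (s.map (e a)).sum) (n' + (s.map (e' a)).sum))
    (l : List X) (F F' : List X → List X → ℤ → M)
    (h : ∀ s t n n', R l s t n n' → F s t n = F' s t n') :
    shSum e l F = shSum e' l F' := by
  induction l generalizing F F' with
  | nil => simpa using h _ _ _ _ h0
  | cons a l ih =>
    rw [shSum_cons, shSum_cons]
    refine ih _ _ fun s t n n' hR => ?_
    rw [h _ _ _ _ (h1 a _ _ _ _ _ hR), h _ _ _ _ (h2 a _ _ _ _ _ hR)]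

lemma shSum_eq_zero (e : X → X → ℤ) (l : List X) (F : List X → List X → ℤ → M)
    (h : ∀ s t n, F s t n = 0) : shSum e l F = 0 := by
  simp [shSum, h]

@[simp] lemma totalDeg_nil (deg : X → ℤ) : totalDeg deg [] = 0 := rfl

@[simp] lemma totalDeg_cons (deg : X → ℤ) (a : X) (l : List X) :
    totalDeg deg (a :: l) = deg a + totalDeg deg l := by simp [totalDeg]

@[simp] lemma totalDeg_append (deg : X → ℤ) (l l' : List X) :
    totalDeg deg (l ++ l') = totalDeg deg l + totalDeg deg l' := by simp [totalDeg]

lemma sum_map_symExp (deg : X → ℤ) (a : X) (l : List X) :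
    (l.map (symExp deg a)).sum = deg a * totalDeg deg l := by
  induction l with
  | nil => simp
  | cons b l ih => simp [ih, symExp, mul_add]

lemma shSum_congr_totalDeg {e : X → X → ℤ} (deg : X → ℤ) (l : List X)
    (F F' : List X → List X → ℤ → M)
    (h : ∀ s t n, totalDeg deg l = totalDeg deg s + totalDeg deg t → F s t n = F' s t n) :
    shSum e l F = shSum e l F' := by
  refine shSum_congr_of_rel
    (fun l s t n n' => n = n' ∧ totalDeg deg l = totalDeg deg s + totalDeg deg t)
    (by simp) ?_ ?_ l F F' ?_
  · rintro a l s t n _ ⟨rfl, h⟩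
    simp [h, add_assoc]
  · rintro a l s t n _ ⟨rfl, h⟩
    simp [h, add_left_comm]
  · rintro s t n _ ⟨rfl, h'⟩
    exact h s t n h'

lemma shSum_of_left_nil (e : X → X → ℤ) (l : List X) (F : List X → List X → ℤ → M)
    (h : ∀ s t n, s ≠ [] → F s t n = 0) : shSum e l F = F [] l 0 := by
  induction l generalizing F with
  | nil => simp
  | cons a l ih =>
    rw [shSum_cons, ih]
    · simp [h]
    · intro s t n hs
      simp [h, hs]

lemma shSum_map (e : Y → Y → ℤ) (f : X → Y) (l : List X) (F : List Y → List Y → ℤ → M) :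
    shSum e (l.map f) F =
      shSum (fun a b => e (f a) (f b)) l fun s t n => F (s.map f) (t.map f) n := by
  induction l generalizing F with
  | nil => simp
  | cons a l ih =>
    rw [List.map_cons, shSum_cons, shSum_cons, ih]
    simp [Function.comp_def]

/-- A pair of letters from different parts is interchanged in exactly one of the rearrangements `l →
s t` and `l → t s`, so the two exponents add up to `|s| |t|`. -/
lemma shSum_swap (deg : X → ℤ) (l : List X) (F : List X → List X → ℤ → M) :
    shSum (symExp deg) l F = shSum (symExp deg) l fun s t n =>
      F t s (totalDeg deg s * totalDeg deg t - n) := by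
  induction l generalizing F with
  | nil => simp
  | cons a l ih =>
    rw [shSum_cons, shSum_cons, ih]
    congr 1
    funext s t n
    rw [add_comm]
    simp only [sum_map_symExp, totalDeg_cons]
    congr 2 <;> ring

lemma finite_support_shSum {I : Type*} (e : X → X → ℤ) (l : List X)
    (F : I → List X → List X → ℤ → M)
    (h : ∀ s t n, (Function.support fun a => F a s t n).Finite) :
    (Function.support fun a => shSum e l (F a)).Finite := by
  induction l generalizing F with
  | nil => simpa using h [] [] 0
  | cons a l ih =>
    simp only [shSum_cons]
    refine ih _ fun s t n => ?_
    exact ((h _ _ _).union (h _ _ _)).subset (Function.support_add _ _)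

lemma finsum_shSum {I : Type*} (e : X → X → ℤ) (l : List X)
    (F : I → List X → List X → ℤ → M)
    (h : ∀ s t n, (Function.support fun a => F a s t n).Finite) :
    ∑ᶠ a, shSum e l (F a) = shSum e l fun s t n => ∑ᶠ a, F a s t n := by
  induction l generalizing F with
  | nil => simp
  | cons a l ih =>
    simp only [shSum_cons]
    rw [ih]
    · congr 1
      funext s t n
      exact finsum_add_distrib (h _ _ _) (h _ _ _)
    · intro s t n
      exact ((h _ _ _).union (h _ _ _)).subset (Function.support_add _ _)

end ShuffleSums

/-! ### The calculus of formal forms -/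

section Calculus

variable {K ι : Type*} [Field K] (deg : ι → ℤ)

lemma Form.mul_apply (f g : Form K ι) (α β : List ι) :
    Form.mul deg f g α β = shSum (symExp deg) α fun s t n =>
      shSum (symExp (dtDeg deg)) β fun u v k =>
        sgn K (n + k + totalDeg (dtDeg deg) u * totalDeg deg t) * (f s u * g t v) := rfl

/-- The automorphism of the algebra of forms that multiplies a form of parity `q` by
`(-1)^(z q)`. -/
def twist (z : ℤ) (f : Form K ι) : Form K ι := fun α β =>
  sgn K (z * (totalDeg deg α + totalDeg (dtDeg deg) β)) * f α β

/-- The pointwise sum of a family of forms. -/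
noncomputable def fsum {I : Type*} (f : I → Form K ι) : Form K ι := fun α β => ∑ᶠ a, f a α β

/-- Each coefficient of the family vanishes for all but finitely many members. -/
def LocFinite {I : Type*} (f : I → Form K ι) : Prop :=
  ∀ α β, (Function.support fun a => f a α β).Finite

open Classical in
/-- The form `1`. -/
noncomputable def oneForm : Form K ι := fun α β => if α = [] ∧ β = [] then 1 else 0

lemma zmod_two_mul_self (x : ZMod 2) : x * x = x := by
  revert x; decide

lemma add_mul' (f g h : Form K ι) :
    Form.mul deg (f + g) h = Form.mul deg f h + Form.mul deg g h := by
  funext α β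
  simp only [Form.mul_apply, Pi.add_apply, add_mul, mul_add, shSum_add]

lemma mul_add' (f g h : Form K ι) :
    Form.mul deg f (g + h) = Form.mul deg f g + Form.mul deg f h := by
  funext α β
  simp only [Form.mul_apply, Pi.add_apply, mul_add, shSum_add]

lemma smul_mul' (c : K) (f g : Form K ι) :
    Form.mul deg (c • f) g = c • Form.mul deg f g := by
  funext α β
  simp only [Form.mul_apply, Pi.smul_apply, smul_eq_mul, mul_shSum, mul_left_comm c, mul_assoc]

lemma mul_smul' (c : K) (f g : Form K ι) :
    Form.mul deg f (c • g) = c • Form.mul deg f g := by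
  funext α β
  simp only [Form.mul_apply, Pi.smul_apply, smul_eq_mul, mul_shSum, mul_left_comm c]

@[simp] lemma zero_mul' (f : Form K ι) : Form.mul deg 0 f = 0 := by
  simpa using smul_mul' deg (0 : K) 0 f

@[simp] lemma mul_zero' (f : Form K ι) : Form.mul deg f 0 = 0 := by
  simpa using mul_smul' deg (0 : K) f 0

/-- In an unshuffle of `a :: α` the letter `a` goes to one of the two factors, which is the Leibniz
rule. Using `twist` for the sign of passing `f` makes the rule valid for inhomogeneous `f`. -/
lemma partialT_mul (a : ι) (f g : Form K ι) :
    partialT a (Form.mul deg f g) =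
      Form.mul deg (partialT a f) g + Form.mul deg (twist deg (deg a) f) (partialT a g) := by
  funext α β
  simp only [partialT, Form.mul_apply, Pi.add_apply, shSum_cons']
  congr 2
  funext s t n
  congr 1
  funext u v k
  simp only [twist, sum_map_symExp, totalDeg_cons, ← mul_assoc, ← sgn_add]
  congr 3
  ring

lemma partialDt_mul (a : ι) (f g : Form K ι) :
    partialDt deg a (Form.mul deg f g) =
      Form.mul deg (partialDt deg a f) g
        + Form.mul deg (twist deg (dtDeg deg a) f) (partialDt deg a g) := by
  funext α β
  simp only [partialDt, Form.mul_apply, Pi.add_apply, shSum_cons', mul_shSum, shSum_add, mul_add]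
  congr 1 <;> refine shSum_congr_totalDeg deg _ _ _ fun s t n h => ?_ <;> congr 1 <;>
    funext u v k <;> simp only [twist, sum_map_symExp, totalDeg_cons, h]
  · simp only [← mul_assoc, ← sgn_add]
    congr 2
    apply sgn_congr
    push_cast
    grind
  · rw [mul_mul_mul_comm]
    simp only [← mul_assoc, ← sgn_add]
    congr 2
    apply sgn_congr
    push_cast
    grind

lemma partialT_partialDt (a b : ι) (f : Form K ι) :
    partialT b (partialDt deg a f) =
      sgn K (dtDeg deg a * deg b) • partialDt deg a (partialT b f) := by
  funext α β
  simp only [partialT, partialDt, Pi.smul_apply, smul_eq_mul, totalDeg_cons, mul_add, sgn_add,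
    mul_assoc]

lemma partialT_add (a : ι) (f g : Form K ι) :
    partialT a (f + g) = partialT a f + partialT a g := rfl

lemma partialDt_smul (a : ι) (c : K) (f : Form K ι) :
    partialDt deg a (c • f) = c • partialDt deg a f := by
  funext α β
  simp [partialDt, mul_left_comm]

lemma partialDt_add (a : ι) (f g : Form K ι) :
    partialDt deg a (f + g) = partialDt deg a f + partialDt deg a g := by
  funext α β
  simp [partialDt, mul_add]

/-- Trades the first `dt` for a derivative, so identities between forms can be proved by induction
on `β`: compare the coefficients without `dt`'s, then apply `partialDt`. -/
lemma apply_cons_eq (f : Form K ι) (α : List ι) (x : ι) (β : List ι) :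
    f α (x :: β) = sgn K (dtDeg deg x * totalDeg deg α) * partialDt deg x f α β := by
  rw [partialDt, ← mul_assoc, sgn_mul_self, one_mul]

lemma twist_smul (z : ℤ) (c : K) (f : Form K ι) :
    twist deg z (c • f) = c • twist deg z f := by
  funext α β
  simp [twist, mul_left_comm]

lemma twist_add (z : ℤ) (f g : Form K ι) :
    twist deg z (f + g) = twist deg z f + twist deg z g := by
  funext α β
  simp [twist, mul_add]

lemma twist_twist (y z : ℤ) (f : Form K ι) :
    twist deg y (twist deg z f) = twist deg (y + z) f := by
  funext α β
  simp [twist, add_mul, sgn_add, mul_assoc]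

lemma twist_congr {y z : ℤ} (h : (y : ZMod 2) = z) (f : Form K ι) :
    twist deg y f = twist deg z f := by
  funext α β
  simp only [twist]
  congr 1
  apply sgn_congr
  push_cast
  rw [h]

lemma partialDt_twist (z : ℤ) (x : ι) (f : Form K ι) :
    partialDt deg x (twist deg z f) =
      sgn K (z * dtDeg deg x) • twist deg z (partialDt deg x f) := by
  funext α β
  simp only [partialDt, twist, Pi.smul_apply, smul_eq_mul, totalDeg_cons, ← mul_assoc, ← sgn_add]
  ring_nf

lemma partialDt_dcoord (x b : ι) [Decidable (x = b)] :
    partialDt deg x (dcoord b : Form K ι) =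
      if x = b then oneForm else 0 := by
  funext α β
  by_cases h : x = b <;> by_cases h2 : α = [] <;> simp [partialDt, oneForm, dcoord, h, h2]

lemma partialT_dcoord (x b : ι) : partialT x (dcoord b : Form K ι) = 0 := by
  funext α β
  simp [partialT, dcoord]

lemma one_mul' (g : Form K ι) :
    Form.mul deg oneForm g = g := by
  funext α β
  rw [Form.mul_apply, shSum_of_left_nil, shSum_of_left_nil]
  · simp [oneForm]
  · intro s t n hs; simp [oneForm, hs]
  · intro s t n hs
    exact shSum_eq_zero _ _ _ fun _ _ _ => by simp [oneForm, hs]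

lemma twist_dcoord (z : ℤ) (b : ι) :
    twist deg z (dcoord b : Form K ι) = sgn K (z * dtDeg deg b) • dcoord b := by
  funext α β
  by_cases h : α = [] ∧ β = [b]
  · simp [twist, dcoord, h.1, h.2]
  · simp [twist, dcoord, h]

lemma partialDt_dcoord_mul (x b : ι) [Decidable (x = b)] (h : Form K ι) :
    partialDt deg x (Form.mul deg (dcoord b) h) =
      (if x = b then h else 0) +
        sgn K (dtDeg deg x * dtDeg deg b) • Form.mul deg (dcoord b) (partialDt deg x h) := by
  rw [partialDt_mul, partialDt_dcoord, twist_dcoord, smul_mul']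
  split_ifs
  · rw [one_mul']
  · rw [zero_mul']

lemma dcoord_mul_nil (b : ι) (h : Form K ι) (α : List ι) :
    Form.mul deg (dcoord b) h α [] = 0 := by
  rw [Form.mul_apply]
  exact shSum_eq_zero _ _ _ fun s t n => by simp [dcoord]

/-- The factor `dt^b` contributes to a monomial `dt^β` only if `b` occurs in `β`. -/
lemma locFinite_dcoord_mul (h : ι → Form K ι) :
    LocFinite fun b => Form.mul deg (dcoord b) (h b) := by
  classical
  intro α β
  refine (List.finite_toSet β).subset ?_
  intro b hb
  by_contra hmem
  refine hb ?_
  change Form.mul deg (dcoord b) (h b) α β = 0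
  -- Each step of the induction replaces the second factor by one of its derivatives, so it has to
  -- be arbitrary.
  generalize h b = g
  clear hb
  induction β generalizing g with
  | nil => simp [dcoord_mul_nil]
  | cons x β ih =>
    simp only [Set.mem_ofPred_eq, List.mem_cons, not_or] at hmem ih
    have := ih (by simpa using hmem.2)
    simp [apply_cons_eq deg _ α x β, partialDt_dcoord_mul, Ne.symm hmem.1, this]

lemma deRham_nil (f : Form K ι) (α : List ι) : deRham deg f α [] = 0 := by
  simp [deRham, dcoord_mul_nil]

/-- The Cartan-type relation `[∂/∂(dt^x), d] = ∂/∂t^x`. Together with `deRham_nil` it determines `d`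
recursively, without reference to the infinite sum. -/
lemma partialDt_deRham (x : ι) (f : Form K ι) :
    partialDt deg x (deRham deg f) =
      partialT x f + sgn K (dtDeg deg x) • deRham deg (partialDt deg x f) := by
  classical
  funext α β
  have h1 : partialDt deg x (deRham deg f) α β =
      ∑ᶠ b, partialDt deg x (Form.mul deg (dcoord b) (partialT b f)) α β := by
    simp only [partialDt, deRham, mul_finsum]
  have h2 : ∀ b, partialDt deg x (Form.mul deg (dcoord b) (partialT b f)) α β =
      (if x = b then partialT b f α β else 0) + sgn K (dtDeg deg x) *
        Form.mul deg (dcoord b) (partialT b (partialDt deg x f)) α β := by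
    intro b
    rw [partialDt_dcoord_mul, partialT_partialDt, mul_smul']
    simp only [Pi.add_apply, Pi.smul_apply, smul_eq_mul, ← mul_assoc, ← sgn_add]
    congr 1
    · split_ifs <;> rfl
    · congr 1
      apply sgn_congr
      simp only [dtDeg]
      push_cast
      grind
  rw [h1, finsum_congr h2, finsum_add_distrib]
  · simp only [Pi.add_apply, Pi.smul_apply, smul_eq_mul, deRham, mul_finsum]
    congr 1
    rw [finsum_eq_single _ x]
    · simp
    · intro b hb
      simp [Ne.symm hb]
  · refine (Set.finite_singleton x).subset fun b hb => ?_
    by_contra h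
    exact hb (by simp [Ne.symm (show b ≠ x from h)])
  · refine (locFinite_dcoord_mul deg (fun b => partialT b (partialDt deg x f)) α β).subset ?_
    exact Function.support_mul_subset_right _ _

lemma deRham_cons (f : Form K ι) (α β : List ι) (x : ι) :
    deRham deg f α (x :: β) = sgn K (dtDeg deg x * totalDeg deg α) *
      (f (x :: α) β + sgn K (dtDeg deg x) * deRham deg (partialDt deg x f) α β) := by
  rw [apply_cons_eq deg (deRham deg f), partialDt_deRham]; rfl

lemma deRham_add (f g : Form K ι) : deRham deg (f + g) = deRham deg f + deRham deg g := by
  funext α β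
  induction β generalizing f g α with
  | nil => simp [deRham_nil]
  | cons x β ih =>
    simp only [Pi.add_apply, deRham_cons, partialDt_add, ih]
    ring

lemma deRham_smul (c : K) (f : Form K ι) : deRham deg (c • f) = c • deRham deg f := by
  funext α β
  induction β generalizing f α with
  | nil => simp [deRham_nil]
  | cons x β ih =>
    simp only [Pi.smul_apply, smul_eq_mul, deRham_cons, partialDt_smul, ih]
    ring

@[simp] lemma deRham_zero : deRham deg (0 : Form K ι) = 0 := by
  simpa using deRham_smul deg (0 : K) 0

lemma twist_deRham (z : ℤ) (f : Form K ι) :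
    twist deg z (deRham deg f) = sgn K z • deRham deg (twist deg z f) := by
  funext α β
  induction β generalizing f α with
  | nil => simp [deRham_nil, twist]
  | cons x β ih =>
    rw [apply_cons_eq deg (twist deg z _), partialDt_twist, partialDt_deRham]
    simp only [Pi.smul_apply, smul_eq_mul, deRham_cons, partialDt_twist, deRham_smul, twist_add,
      twist_smul, ih, Pi.add_apply]
    simp only [twist, totalDeg_cons, mul_add, ← mul_assoc, ← sgn_add]
    congr 2 <;> · apply sgn_congr; simp only [dtDeg]; push_cast; grind

/-- By induction on `β`: after `∂/∂(dt^x)` is moved inside, the Leibniz rules for the two kinds of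
derivatives and the induction hypothesis give the same terms on both sides. -/
lemma deRham_mul (f g : Form K ι) :
    deRham deg (Form.mul deg f g) =
      Form.mul deg (deRham deg f) g + Form.mul deg (twist deg 1 f) (deRham deg g) := by
  funext α β
  induction β generalizing f g α with
  | nil =>
    simp [deRham_nil, Form.mul_apply, shSum_eq_zero]
  | cons x β ih =>
    rw [apply_cons_eq deg (deRham deg _), apply_cons_eq deg (_ + _), partialDt_deRham, partialDt_add]
    congr 1
    simp only [partialT_mul, partialDt_mul, partialDt_deRham, partialDt_twist, deRham_add,
      Pi.add_apply, Pi.smul_apply, ih, add_mul', mul_add', smul_mul', mul_smul', twist_deRham,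
      twist_twist, smul_eq_mul]
    have e1 : twist deg (dtDeg deg x + 1) f = twist deg (deg x) f :=
      twist_congr deg (by simp only [dtDeg]; push_cast; grind) f
    have e2 : twist deg (1 + dtDeg deg x) f = twist deg (deg x) f := by rw [add_comm, e1]
    rw [e1, e2, one_mul]
    ring

end Calculus

/-! ### Lie derivations along vector-valued forms of degree one -/

section LieDerivations

variable {K ι : Type*} [Field K] (deg : ι → ℤ)

lemma locFinite_mul {I : Type*} {L : I → Form K ι} (hL : LocFinite L) (h : I → Form K ι) :
    LocFinite fun a => Form.mul deg (L a) (h a) := by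
  intro α β
  simp only [Form.mul_apply]
  refine finite_support_shSum _ _ _ fun s t n => finite_support_shSum _ _ _ fun u v k => ?_
  refine (hL s u).subset fun a ha h0 => ha ?_
  simp only at h0
  simp [h0]

/-- Local finiteness matters because `finsum` takes the default value 0 on families of infinite
support and is not additive there. -/
lemma fsum_add {I : Type*} {f g : I → Form K ι} (hf : LocFinite f) (hg : LocFinite g) :
    fsum (fun a => f a + g a) = fsum f + fsum g := by
  funext α β
  exact finsum_add_distrib (hf α β) (hg α β)

lemma locFinite_smul {I : Type*} {f : I → Form K ι} (hf : LocFinite f) (c : I → K) :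
    LocFinite fun a => c a • f a := fun α β =>
  (hf α β).subset (Function.support_mul_subset_right _ _)

lemma locFinite_partialDt {I : Type*} {f : I → Form K ι} (hf : LocFinite f) (x : ι) :
    LocFinite fun a => partialDt deg x (f a) := fun α β =>
  (hf α (x :: β)).subset (Function.support_mul_subset_right _ _)

lemma partialDt_fsum {I : Type*} (f : I → Form K ι) (x : ι) :
    partialDt deg x (fsum f) = fsum fun a => partialDt deg x (f a) := by
  funext α β
  simp only [partialDt, fsum, mul_finsum]

lemma locFinite_deRham {I : Type*} {f : I → Form K ι} (hf : LocFinite f) :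
    LocFinite fun a => deRham deg (f a) := by
  intro α β
  induction β generalizing f α with
  | nil => simp [deRham_nil]
  | cons x β ih =>
    simp only [deRham_cons]
    refine Set.Finite.subset ?_ (Function.support_mul_subset_right _ _)
    refine Set.Finite.subset (Set.Finite.union (hf (x :: α) β) ?_) (Function.support_add _ _)
    exact (ih (locFinite_partialDt deg hf x) α).subset (Function.support_mul_subset_right _ _)

lemma deRham_fsum {I : Type*} {f : I → Form K ι} (hf : LocFinite f) :
    deRham deg (fsum f) = fsum fun a => deRham deg (f a) := by
  funext α β
  induction β generalizing f α with
  | nil => simp [deRham_nil, fsum]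
  | cons x β ih =>
    rw [deRham_cons, partialDt_fsum, ih (locFinite_partialDt deg hf x)]
    simp only [fsum, deRham_cons]
    rw [mul_finsum, ← finsum_add_distrib (hf _ _), mul_finsum]
    exact (locFinite_deRham deg (locFinite_partialDt deg hf x) α β).subset
      (Function.support_mul_subset_right _ _)

lemma insertion_eq (L : VForm K ι) (f : Form K ι) :
    insertion deg L f = fsum fun a => Form.mul deg (L a) (partialDt deg a f) := rfl

lemma vfAct_eq (L : VForm K ι) (f : Form K ι) :
    vfAct deg L f = fsum fun a => Form.mul deg (L a) (partialT a f) := rfl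

/-- The derivation `∑_a L^a ∂/∂(dt^a)` for a family `L` of forms that need not be the components
of `L` but, for instance, their differentials. -/
noncomputable def insertionD (L : VForm K ι) (f : Form K ι) : Form K ι :=
  insertion deg (fun a => deRham deg (L a)) f

/-- The components of a vector-valued form of total degree one: locally finite, and `L^a` has the
parity of `dt^a`. -/
structure IsDegOne (L : VForm K ι) : Prop where
  locFinite : LocFinite L
  twist : ∀ a z, twist deg z (L a) = sgn K (z * dtDeg deg a) • L a

variable {deg}

/-- As `i_L` has degree 0, the derivation is `i_L d - d i_L`. Both products contain `∑ ± L^a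
d(∂f/∂(dt^a))`, with equal signs because `L^a` has the parity of `dt^a`, so a first-order expression
is left. -/
lemma IsDegOne.lieDerivation_apply {L : VForm K ι} (hL : IsDegOne deg L) (f : Form K ι) :
    lieDerivation deg 1 L f = vfAct deg L f - insertionD deg L f := by
  have h1 : insertion deg L (deRham deg f) = vfAct deg L f + fsum fun a =>
      sgn K (dtDeg deg a) • Form.mul deg (L a) (deRham deg (partialDt deg a f)) := by
    rw [vfAct_eq, ← fsum_add (locFinite_mul deg hL.locFinite _)
      (locFinite_smul (locFinite_mul deg hL.locFinite _) _), insertion_eq]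
    simp only [partialDt_deRham, mul_add', mul_smul']
  have h2 : deRham deg (insertion deg L f) = insertionD deg L f + fsum fun a =>
      sgn K (dtDeg deg a) • Form.mul deg (L a) (deRham deg (partialDt deg a f)) := by
    rw [insertion_eq, deRham_fsum deg (locFinite_mul deg hL.locFinite _), insertionD, insertion_eq,
      ← fsum_add (locFinite_mul deg (locFinite_deRham deg hL.locFinite) _)
      (locFinite_smul (locFinite_mul deg hL.locFinite _) _)]
    simp only [deRham_mul, hL.twist, smul_mul', one_mul]
  simp only [lieDerivation, gradedComm, h1, h2]
  simp

lemma vfAct_coord (L : VForm K ι) (c : ι) : vfAct deg L (coord c) = L c := by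
  classical
  have h : ∀ a, partialT a (coord c : Form K ι) = if a = c then oneForm else 0 := by
    intro a
    funext α β
    by_cases h : a = c <;> by_cases h2 : α = [] <;> simp [partialT, coord, oneForm, h, h2]
  funext α β
  simp only [vfAct, h]
  rw [finsum_eq_single _ c]
  · rw [if_pos rfl, Form.mul_apply]
    rw [shSum_swap, shSum_of_left_nil, shSum_swap, shSum_of_left_nil]
    · simp [oneForm]
    · intro s t n hs; simp [oneForm, hs]
    · intro s t n hs
      exact shSum_eq_zero _ _ _ fun _ _ _ => by simp [oneForm, hs]
  · intro a ha
    simp [ha]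

lemma insertion_dcoord (L : VForm K ι) (c : ι) : insertion deg L (dcoord c) = L c := by
  classical
  funext α β
  rw [← vfAct_coord (deg := deg) L c]
  -- Both derivatives are the Kronecker symbol, which carries the computation over from `t^c` to
  -- `dt^c`.
  have h : ∀ a, partialT a (coord c : Form K ι) = partialDt deg a (dcoord c) := by
    intro a
    rw [partialDt_dcoord]
    funext α β
    by_cases h : a = c <;> by_cases h2 : α = [] <;> simp [partialT, coord, oneForm, h, h2]
  simp only [insertion, vfAct, h]

lemma insertion_coord (L : VForm K ι) (c : ι) : insertion deg L (coord c) = 0 := by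
  have h : ∀ a, partialDt deg a (coord c : Form K ι) = 0 := by
    intro a
    funext α β
    simp [partialDt, coord]
  funext α β
  simp [insertion, h]

lemma IsDegOne.lieDerivation_coord {L : VForm K ι} (hL : IsDegOne deg L) (c : ι) :
    lieDerivation deg 1 L (coord c) = L c := by
  rw [hL.lieDerivation_apply, vfAct_coord, insertionD, insertion_coord, sub_zero]

/-- A vector field of degree one and a vector-valued form of degree one without vector field part
satisfy the two structure equations if and only if the Lie derivation along their sum annihilates
the components of the sum. -/
lemma structure_equations_iff [NeZero (2 : K)] {X L : VForm K ι}
    (hX : IsDegOne deg X) (hL : IsDegOne deg L) (hX0 : ∀ c α β, β ≠ [] → X c α β = 0)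
    (hL0 : ∀ c α, L c α [] = 0) :
    (vfBracket deg 1 1 X X = 0 ∧
      lieDerivative deg 1 1 X L + (1 / 2 : K) • fnBracket deg 1 1 L L = 0) ↔
    ∀ c, vfAct deg (X + L) ((X + L) c) - insertionD deg (X + L) ((X + L) c) = 0 := by
  have h2 : (2 : K) ≠ 0 := NeZero.ne _
  have hXdt : ∀ a c, partialDt deg a (X c) = 0 := by
    intro a c
    funext α β
    simp [partialDt, hX0]
  have hbr : ∀ c, vfBracket deg 1 1 X X c = (2 : K) • vfAct deg X (X c) := by
    intro c
    simp only [vfBracket, gradedComm, vfAct_coord, mul_one, sgn_one, neg_smul, one_smul,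
      sub_neg_eq_add, two_smul]
  have hLdX : ∀ c, insertion deg L (deRham deg (X c)) = vfAct deg L (X c) := by
    intro c
    simp only [insertion_eq, partialDt_deRham, hXdt, deRham_zero, smul_zero, add_zero, vfAct_eq]
  have hi : ∀ (M : VForm K ι) (f : Form K ι), insertion deg M (-f) = - insertion deg M f := by
    intro M f
    have h : ∀ a, partialDt deg a (-f) = (-1 : K) • partialDt deg a f := by
      intro a
      rw [← partialDt_smul, neg_one_smul]
    funext α β
    simp only [insertion, h, mul_smul', Pi.smul_apply, Pi.neg_apply]
    rw [← smul_finsum, neg_one_smul]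
  have hlie : ∀ c, lieDerivative deg 1 1 X L c =
      vfAct deg X (L c) - insertionD deg X (L c) + vfAct deg L (X c) := by
    intro c
    have hv : vfAct deg X (dcoord c) = 0 := by
      funext α β
      simp [vfAct, partialT_dcoord]
    have : lieDerivation deg 1 X (dcoord c) = - deRham deg (X c) := by
      rw [hX.lieDerivation_apply, hv, insertionD, insertion_dcoord, zero_sub]
    simp only [lieDerivative, gradedComm, insertion_dcoord, this, hi, hLdX]
    rw [hX.lieDerivation_apply]
    simp
  have hfn : ∀ c, fnBracket deg 1 1 L L c =
      (2 : K) • (vfAct deg L (L c) - insertionD deg L (L c)) := by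
    intro c
    simp only [fnBracket, gradedComm, hL.lieDerivation_coord, hL.lieDerivation_apply (L c), mul_one,
      sgn_one, neg_smul, one_smul, sub_neg_eq_add, two_smul]
  have hact : ∀ f, vfAct deg (X + L) f = vfAct deg X f + vfAct deg L f := by
    intro f
    simp only [vfAct_eq, Pi.add_apply, add_mul']
    exact fsum_add (locFinite_mul deg hX.locFinite _) (locFinite_mul deg hL.locFinite _)
  have hins : ∀ f, insertionD deg (X + L) f = insertionD deg X f + insertionD deg L f := by
    intro f
    simp only [insertionD, insertion_eq, Pi.add_apply, deRham_add, add_mul']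
    exact fsum_add (locFinite_mul deg (locFinite_deRham deg hX.locFinite) _)
      (locFinite_mul deg (locFinite_deRham deg hL.locFinite) _)
  have hactadd : ∀ (M : VForm K ι), LocFinite M → ∀ f g,
      vfAct deg M (f + g) = vfAct deg M f + vfAct deg M g := by
    intro M hM f g
    simp only [vfAct_eq, partialT_add, mul_add']
    exact fsum_add (locFinite_mul deg hM _) (locFinite_mul deg hM _)
  have hinsadd : ∀ (M : VForm K ι) c, insertionD deg M (X c + L c) = insertionD deg M (L c) := by
    intro M c
    simp only [insertionD, insertion_eq, partialDt_add, hXdt, zero_add]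
  -- Expansion by bilinearity; `X^c` contains no `dt`, so it contributes nothing to the insertion
  -- terms.
  have htot : ∀ c, vfAct deg (X + L) ((X + L) c) - insertionD deg (X + L) ((X + L) c) =
      vfAct deg X (X c) + (lieDerivative deg 1 1 X L + (1 / 2 : K) • fnBracket deg 1 1 L L) c := by
    intro c
    simp only [Pi.add_apply, Pi.smul_apply, hact, hins, hactadd _ hX.locFinite,
      hactadd _ hL.locFinite, hinsadd, hlie, hfn, smul_smul]
    rw [one_div, inv_mul_cancel₀ h2, one_smul]
    abel
  have hXX : ∀ c α β, β ≠ [] → vfAct deg X (X c) α β = 0 := by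
    intro c α β hβ
    simp only [vfAct]
    refine finsum_eq_zero_of_forall_eq_zero fun a => ?_
    rw [Form.mul_apply]
    refine shSum_eq_zero _ _ _ fun s t n => ?_
    rw [shSum_of_left_nil]
    · simp [partialT, hX0 _ _ _ hβ]
    · intro u v k hu
      simp [hX0 _ _ _ hu]
  have hrest : ∀ c α,
      (lieDerivative deg 1 1 X L + (1 / 2 : K) • fnBracket deg 1 1 L L) c α [] = 0 := by
    intro c α
    have e1 : ∀ (M : VForm K ι), insertionD deg M (L c) α [] = 0 := by
      intro M
      simp only [insertionD, insertion]
      refine finsum_eq_zero_of_forall_eq_zero fun a => ?_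
      rw [Form.mul_apply]
      refine shSum_eq_zero _ _ _ fun s t n => ?_
      simp [deRham_nil]
    have e2 : ∀ M : VForm K ι, vfAct deg M (L c) α [] = 0 := by
      intro M
      simp only [vfAct]
      refine finsum_eq_zero_of_forall_eq_zero fun a => ?_
      rw [Form.mul_apply]
      refine shSum_eq_zero _ _ _ fun s t n => ?_
      simp [partialT, hL0]
    have e3 : ∀ f, vfAct deg L f α [] = 0 := by
      intro f
      simp only [vfAct]
      refine finsum_eq_zero_of_forall_eq_zero fun a => ?_
      rw [Form.mul_apply]
      refine shSum_eq_zero _ _ _ fun s t n => ?_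
      simp [hL0]
    simp [hlie, hfn, e1, e2, e3]
  simp only [htot]
  constructor
  · rintro ⟨h, h'⟩ c
    have hc : vfAct deg X (X c) = 0 := by
      have := congrFun h c
      rw [hbr] at this
      exact (smul_eq_zero.1 this).resolve_left h2
    rw [hc, h', zero_add, Pi.zero_apply]
  · intro h
    -- The two summands of `htot` live in form degree zero and in positive form degree, so they
    -- vanish separately.
    have hsplit : ∀ c α β, vfAct deg X (X c) α β = 0 ∧
        (lieDerivative deg 1 1 X L + (1 / 2 : K) • fnBracket deg 1 1 L L) c α β = 0 := by
      intro c α β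
      have h' := congrFun (congrFun (h c) α) β
      rw [Pi.add_apply, Pi.add_apply] at h'
      by_cases hβ : β = []
      · subst hβ
        rw [hrest, add_zero] at h'
        exact ⟨h', hrest c α⟩
      · rw [hXX c α β hβ, zero_add] at h'
        exact ⟨hXX c α β hβ, h'⟩
    constructor
    · funext c
      rw [hbr]
      funext α β
      simp [(hsplit c α β).1]
    · funext c α β
      exact (hsplit c α β).2

end LieDerivations

/-! ### Reduction of the quadratic relations to basis vectors -/

section Multilinearity

lemma get_append_cons_eq {V : Type*} (v v' : List V) (x y : V) (i : ℕ) (hi hi') :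
    (v ++ x :: v')[i]'hi = if i = v.length then x else (v ++ y :: v')[i]'hi' := by
  have hs : v ++ x :: v' = (v ++ y :: v').set v.length x := by simp
  simp only [hs, List.getElem_set, eq_comm]

variable {K V : Type*} [Field K] [AddCommGroup V] [Module K V]

/-- The arities in `evalOp` are lengths of words and change form with them. Fixing `k` and `p` lets
a change of one letter be written as a `Function.update`. -/
lemma evalOp_eq (μ : (k p : ℕ) → MultilinearMap K (fun _ : Fin k ⊕ Fin p => V) V) (v w : List V)
    {k p : ℕ} (hk : v.length = k) (hp : w.length = p) :
    evalOp μ v w = μ k p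
      (Sum.elim (fun i => v.get (i.cast hk.symm)) fun i => w.get (i.cast hp.symm)) := by
  subst hk hp
  rfl

lemma evalOp_isLinearMap_left
    (μ : (k p : ℕ) → MultilinearMap K (fun _ : Fin k ⊕ Fin p => V) V) (v v' w : List V) :
    IsLinearMap K fun x => evalOp μ (v ++ x :: v') w := by
  have h : ∀ x, evalOp μ (v ++ x :: v') w = μ (v.length + (v'.length + 1)) w.length
      (Function.update (Sum.elim (fun i => (v ++ 0 :: v').get (i.cast (by simp))) w.get)
        (Sum.inl ⟨v.length, by omega⟩) x) := by
    intro x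
    rw [evalOp_eq μ _ _ (k := v.length + (v'.length + 1)) (by simp) rfl]
    congr 1
    funext i
    rcases i with i | i
    · simp only [Sum.elim_inl, List.get_eq_getElem, Fin.val_cast, Function.update_apply,
        Sum.inl.injEq, Fin.ext_iff]
      exact get_append_cons_eq _ _ _ _ _ _ _
    · simp only [Sum.elim_inr, Function.update_apply, reduceCtorEq, if_false]
      rfl
  constructor
  · intro x y
    simp only [h, MultilinearMap.map_update_add]
  · intro c x
    simp only [h, MultilinearMap.map_update_smul]

lemma evalOp_isLinearMap_right
    (μ : (k p : ℕ) → MultilinearMap K (fun _ : Fin k ⊕ Fin p => V) V) (v w w' : List V) :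
    IsLinearMap K fun x => evalOp μ v (w ++ x :: w') := by
  have h : ∀ x, evalOp μ v (w ++ x :: w') = μ v.length (w.length + (w'.length + 1))
      (Function.update (Sum.elim v.get (fun i => (w ++ 0 :: w').get (i.cast (by simp))))
        (Sum.inr ⟨w.length, by omega⟩) x) := by
    intro x
    rw [evalOp_eq μ _ _ (p := w.length + (w'.length + 1)) rfl (by simp)]
    congr 1
    funext i
    rcases i with i | i
    · simp only [Sum.elim_inl, Function.update_apply, reduceCtorEq, if_false]
      rfl
    · simp only [Sum.elim_inr, List.get_eq_getElem, Fin.val_cast, Function.update_apply,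
        Sum.inr.injEq, Fin.ext_iff]
      exact get_append_cons_eq _ _ _ _ _ _ _
  constructor
  · intro x y
    simp only [h, MultilinearMap.map_update_add]
  · intro c x
    simp only [h, MultilinearMap.map_update_smul]

variable {𝒱 : ℤ → Submodule K V} {M : Type*} [AddCommGroup M] [Module K M]

/-- A function on words of homogeneous elements that is linear in each letter. -/
def LetterLinear (g : List (Homog 𝒱) → M) : Prop :=
  ∀ l l' n, IsLinearMap K fun x : 𝒱 n => g (l ++ ⟨n, x⟩ :: l')

/-- A function on words of homogeneous elements that depends only on the degrees of the letters. -/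
def DegreeOnly {R : Type*} (φ : List (Homog 𝒱) → R) : Prop :=
  ∀ l l' n (x y : 𝒱 n), φ (l ++ ⟨n, x⟩ :: l') = φ (l ++ ⟨n, y⟩ :: l')

lemma LetterLinear.map_add {g : List (Homog 𝒱) → M} (h : LetterLinear g) (l l' : List (Homog 𝒱))
    (n : ℤ) (x y : 𝒱 n) :
    g (l ++ ⟨n, x + y⟩ :: l') = g (l ++ ⟨n, x⟩ :: l') + g (l ++ ⟨n, y⟩ :: l') :=
  (h l l' n).map_add x y

lemma LetterLinear.map_smul {g : List (Homog 𝒱) → M} (h : LetterLinear g) (l l' : List (Homog 𝒱))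
    (n : ℤ) (c : K) (x : 𝒱 n) :
    g (l ++ ⟨n, c • x⟩ :: l') = c • g (l ++ ⟨n, x⟩ :: l') :=
  (h l l' n).map_smul c x

lemma LetterLinear.add {g g' : List (Homog 𝒱) → M} (h : LetterLinear g) (h' : LetterLinear g') :
    LetterLinear fun l => g l + g' l := fun l l' n =>
  ⟨fun x y => by simp only [h.map_add, h'.map_add]; abel,
    fun c x => by simp only [h.map_smul, h'.map_smul, smul_add]⟩

lemma LetterLinear.sub {g g' : List (Homog 𝒱) → M} (h : LetterLinear g) (h' : LetterLinear g') :
    LetterLinear fun l => g l - g' l := fun l l' n =>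
  ⟨fun x y => by simp only [h.map_add, h'.map_add]; abel,
    fun c x => by simp only [h.map_smul, h'.map_smul, smul_sub]⟩

lemma LetterLinear.smul {g : List (Homog 𝒱) → M} (h : LetterLinear g) {φ : List (Homog 𝒱) → K}
    (hφ : DegreeOnly φ) : LetterLinear fun l => φ l • g l := by
  intro l l' n
  have hφ' : ∀ x : 𝒱 n, φ (l ++ ⟨n, x⟩ :: l') = φ (l ++ ⟨n, 0⟩ :: l') := fun x => hφ l l' n x 0
  constructor
  · intro x y
    simp only [h.map_add, smul_add, hφ']
  · intro c x
    simp only [h.map_smul, hφ', smul_comm c]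

lemma LetterLinear.ite {g : List (Homog 𝒱) → M} (h : LetterLinear g) {p : List (Homog 𝒱) → Prop}
    [DecidablePred p] (hp : DegreeOnly p) : LetterLinear fun l => if p l then g l else 0 := by
  have := h.smul (φ := fun l => if p l then 1 else 0) fun l l' n x y => by
    simp only [hp l l' n x y]
  simpa using this

lemma LetterLinear.comp {N : Type*} [AddCommGroup N] [Module K N] {g : List (Homog 𝒱) → M}
    (h : LetterLinear g) {f : M → N} (hf : IsLinearMap K f) : LetterLinear fun l => f (g l) :=
  fun l l' n => ⟨fun x y => by simp only [h.map_add, hf.map_add],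
    fun c x => by simp only [h.map_smul, hf.map_smul]⟩

lemma LetterLinear.cons {g : List (Homog 𝒱) → M} (h : LetterLinear g) (a : Homog 𝒱) :
    LetterLinear fun l => g (a :: l) := fun l l' n => h (a :: l) l' n

lemma LetterLinear.shSum_fixed {X : Type*} (e : X → X → ℤ) (w : List X)
    {F : List (Homog 𝒱) → List X → List X → ℤ → M}
    (h : ∀ s t n, LetterLinear fun l => F l s t n) : LetterLinear fun l => shSum e w (F l) := by
  induction w generalizing F with
  | nil => simpa using h [] [] 0
  | cons a w ih =>
    simp only [shSum_cons]
    exact ih fun s t n => (h _ _ _).add (h _ _ _)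

/-- Every letter lands in exactly one of the two parts, and the exponents see only degrees, so they
stay constant while a letter varies in its `𝒱 n`. -/
lemma LetterLinear.shSum {e : Homog 𝒱 → Homog 𝒱 → ℤ}
    (he : ∀ a a' b b', a.deg = a'.deg → b.deg = b'.deg → e a b = e a' b')
    {F : List (Homog 𝒱) → List (Homog 𝒱) → ℤ → M}
    (h1 : ∀ t n, LetterLinear fun s => F s t n) (h2 : ∀ s n, LetterLinear fun t => F s t n) :
    LetterLinear fun l => shSum e l F := by
  have hd : ∀ a, DegreeOnly fun s : List (Homog 𝒱) => (s.map (e a)).sum := by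
    intro a l l' n x y
    simp [he a a ⟨n, x⟩ ⟨n, y⟩ rfl rfl]
  intro l
  induction l generalizing F with
  | nil =>
    intro l' n
    simp only [List.nil_append, shSum_cons]
    have hx : ∀ (x : 𝒱 n) (s : List (Homog 𝒱)), (s.map (e ⟨n, x⟩)).sum = (s.map (e ⟨n, 0⟩)).sum := by
      intro x s
      congr 2
      funext b
      exact he _ _ _ _ rfl rfl
    simp only [hx]
    have h : ∀ s t k, IsLinearMap K fun x : 𝒱 n =>
        F (⟨n, x⟩ :: s) t k + F s (⟨n, x⟩ :: t) (k + (s.map (e ⟨n, 0⟩)).sum) := by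
      intro s t k
      have e1 := h1 t k [] s n
      have e2 := h2 s (k + (s.map (e ⟨n, 0⟩)).sum) [] t n
      exact ⟨fun x y => by
          have := e1.map_add x y
          have := e2.map_add x y
          simp only [List.nil_append] at *
          simp only [*]
          abel,
        fun c x => by
          have := e1.map_smul c x
          have := e2.map_smul c x
          simp only [List.nil_append] at *
          simp only [*, smul_add]⟩
    constructor
    · intro x y
      rw [← shSum_add]
      congr 1
      funext s t k
      exact (h s t k).map_add x y
    · intro c x
      rw [← DistribSMul.toAddMonoidHom_apply M c, map_shSum]
      congr 1
      funext s t k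
      exact (h s t k).map_smul c x
  | cons a l ih =>
    intro l' n
    simp only [List.cons_append, shSum_cons]
    refine ih ?_ ?_ l' n
    · intro t k
      refine LetterLinear.add ((h1 t k).cons a) ?_
      intro p q n
      have hx : ∀ x : 𝒱 n, ((p ++ ⟨n, x⟩ :: q).map (e a)).sum =
          ((p ++ ⟨n, 0⟩ :: q).map (e a)).sum := fun x => hd a p q n x 0
      simp only [hx]
      exact h1 _ _ p q n
    · intro s k
      exact (h2 (a :: s) k).add ((h2 s _).cons a)

lemma evalOp_letterLinear_left (μ : (k p : ℕ) → MultilinearMap K (fun _ : Fin k ⊕ Fin p => V) V)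
    (v w : List V) : LetterLinear fun l : List (Homog 𝒱) => evalOp μ (vecs l ++ v) w := by
  intro l l' n
  have h := evalOp_isLinearMap_left μ (vecs l) (vecs l' ++ v) w
  simp only [vecs, List.map_append, List.map_cons, List.append_assoc, List.cons_append] at h ⊢
  exact ⟨fun x y => h.map_add x y, fun c x => h.map_smul c x⟩

lemma evalOp_letterLinear_right (μ : (k p : ℕ) → MultilinearMap K (fun _ : Fin k ⊕ Fin p => V) V)
    (v w : List V) : LetterLinear fun l : List (Homog 𝒱) => evalOp μ v (w ++ vecs l) := by
  intro l l' n
  have h := evalOp_isLinearMap_right μ v (w ++ vecs l) (vecs l')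
  simp only [vecs, List.map_append, List.map_cons, List.append_assoc] at h ⊢
  exact ⟨fun x y => h.map_add x y, fun c x => h.map_smul c x⟩

lemma vecs_append (l l' : List (Homog 𝒱)) : vecs (l ++ l') = vecs l ++ vecs l' := by
  simp [vecs]

lemma symExp_congr {a a' b b' : Homog 𝒱} (h : a.deg = a'.deg) (h' : b.deg = b'.deg) :
    symExp Homog.deg a b = symExp Homog.deg a' b' := by
  rw [symExp, symExp, h, h']

lemma skewExp_congr {a a' b b' : Homog 𝒱} (h : a.deg = a'.deg) (h' : b.deg = b'.deg) :
    skewExp Homog.deg a b = skewExp Homog.deg a' b' := by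
  rw [skewExp, skewExp, h, h']

variable (m : Operations 𝒱)

lemma Operations.relSymm_eq (v w : List (Homog 𝒱)) :
    m.relSymm v w = shSum (symExp Homog.deg) v fun s t n =>
      shSum (skewExp Homog.deg) w fun r r' k =>
        sgn K (r'.length + n + k + (1 - r.length) * totalDeg Homog.deg s) •
          evalOp m.μ (vecs s ++ [evalOp m.μ (vecs t) (vecs r)]) (vecs r') := rfl

lemma sum_map_filter {X : Type*} (L : List X) (p : X → Prop) [DecidablePred p] (f : X → M) :
    ((L.filter p).map f).sum = (L.map fun x => if p x then f x else 0).sum := by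
  induction L with
  | nil => simp
  | cons a L ih => by_cases h : p a <;> simp [h, ih]

lemma Operations.relSkew_eq (v w : List (Homog 𝒱)) :
    m.relSkew v w = shSum (symExp Homog.deg) v fun s t n =>
      shSum (skewExp Homog.deg) w fun r r' k =>
        shSum (skewExp Homog.deg) r fun q q' j =>
          if q.length = 1 then
            sgn K (q'.length + r'.length + n + k + j + (1 - q'.length) * totalDeg Homog.deg s) •
              evalOp m.μ (vecs s) (evalOp m.μ (vecs t ++ vecs q) (vecs q') :: vecs r')
          else 0 := by
  simp only [relSkew, sum_map_filter]
  rfl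

lemma Operations.letterLinear_relSymm_left (w : List (Homog 𝒱)) :
    LetterLinear fun v => m.relSymm v w := by
  simp only [relSymm_eq]
  refine LetterLinear.shSum (fun _ _ _ _ => symExp_congr) (fun t n => ?_) (fun s n => ?_) <;>
    refine LetterLinear.shSum_fixed _ _ fun r r' k => ?_
  · exact (evalOp_letterLinear_left _ _ _).smul (fun _ _ _ _ _ => by simp [Homog.deg])
  · refine LetterLinear.smul ?_ (fun _ _ _ _ _ => rfl)
    refine LetterLinear.comp ?_ (evalOp_isLinearMap_left _ _ _ _)
    simpa using evalOp_letterLinear_left (𝒱 := 𝒱) m.μ [] (vecs r)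

lemma Operations.letterLinear_relSymm_right (v : List (Homog 𝒱)) :
    LetterLinear fun w => m.relSymm v w := by
  simp only [relSymm_eq]
  refine LetterLinear.shSum_fixed _ _ fun s t n => ?_
  refine LetterLinear.shSum (fun _ _ _ _ => skewExp_congr) (fun r' k => ?_) (fun r k => ?_)
  · refine LetterLinear.smul ?_ (fun _ _ _ _ _ => by simp)
    refine LetterLinear.comp ?_ (evalOp_isLinearMap_left _ _ _ _)
    exact evalOp_letterLinear_right (𝒱 := 𝒱) m.μ _ []
  · exact (evalOp_letterLinear_right (𝒱 := 𝒱) m.μ _ []).smul (fun _ _ _ _ _ => by simp)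

lemma Operations.letterLinear_relSkew_left (w : List (Homog 𝒱)) :
    LetterLinear fun v => m.relSkew v w := by
  simp only [relSkew_eq]
  refine LetterLinear.shSum (fun _ _ _ _ => symExp_congr) (fun t n => ?_) (fun s n => ?_) <;>
    refine LetterLinear.shSum_fixed _ _ fun r r' k => LetterLinear.shSum_fixed _ _ fun q q' j => ?_
  · refine LetterLinear.ite ?_ (fun _ _ _ _ _ => rfl)
    refine LetterLinear.smul ?_ (fun _ _ _ _ _ => by simp [Homog.deg])
    simpa using evalOp_letterLinear_left (𝒱 := 𝒱) m.μ [] _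
  · refine LetterLinear.ite ?_ (fun _ _ _ _ _ => rfl)
    refine LetterLinear.smul ?_ (fun _ _ _ _ _ => rfl)
    exact (evalOp_letterLinear_left _ _ _).comp (evalOp_isLinearMap_right _ _ [] _)

lemma Operations.letterLinear_relSkew_right (v : List (Homog 𝒱)) :
    LetterLinear fun w => m.relSkew v w := by
  simp only [relSkew_eq]
  refine LetterLinear.shSum_fixed _ _ fun s t n => ?_
  refine LetterLinear.shSum (fun _ _ _ _ => skewExp_congr) (fun r' k => ?_) (fun r k => ?_)
  · refine LetterLinear.shSum (fun _ _ _ _ => skewExp_congr) (fun q' j => ?_) (fun q j => ?_)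
    · refine LetterLinear.ite ?_ (fun _ _ _ _ _ => by simp)
      refine LetterLinear.smul ?_ (fun _ _ _ _ _ => rfl)
      refine LetterLinear.comp (f := fun x => evalOp m.μ (vecs s) (x :: vecs r')) ?_
        (evalOp_isLinearMap_right _ _ [] _)
      intro l l' d
      have h := evalOp_isLinearMap_left m.μ (vecs t ++ vecs l) (vecs l') (vecs q')
      simp only [vecs, List.map_append, List.map_cons, List.append_assoc] at h ⊢
      exact ⟨fun x y => h.map_add x y, fun c x => h.map_smul c x⟩
    · refine LetterLinear.ite ?_ (fun _ _ _ _ _ => rfl)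
      refine LetterLinear.smul ?_ (fun _ _ _ _ _ => by simp)
      refine LetterLinear.comp (f := fun x => evalOp m.μ (vecs s) (x :: vecs r')) ?_
        (evalOp_isLinearMap_right _ _ [] _)
      exact evalOp_letterLinear_right (𝒱 := 𝒱) m.μ _ []
  · refine LetterLinear.shSum_fixed _ _ fun q q' j => ?_
    refine LetterLinear.ite ?_ (fun _ _ _ _ _ => rfl)
    refine LetterLinear.smul ?_ (fun _ _ _ _ _ => by simp)
    exact evalOp_letterLinear_right (𝒱 := 𝒱) m.μ _ [_]

section Basis

variable {ι : Type*} {b : Module.Basis ι K V} {deg : ι → ℤ}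

/-- A basis vector as a homogeneous element. -/
noncomputable def basisLetter (hb : ∀ a, b a ∈ 𝒱 (deg a)) (a : ι) : Homog 𝒱 :=
  ⟨deg a, b a, hb a⟩

@[simp] lemma vecs_map_basisLetter (hb : ∀ a, b a ∈ 𝒱 (deg a)) (α : List ι) :
    vecs (α.map (basisLetter hb)) = α.map b := by
  simp [vecs, basisLetter]

@[simp] lemma deg_basisLetter (hb : ∀ a, b a ∈ 𝒱 (deg a)) (a : ι) :
    (basisLetter hb a).deg = deg a := rfl

lemma totalDeg_map_basisLetter (hb : ∀ a, b a ∈ 𝒱 (deg a)) (α : List ι) :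
    totalDeg Homog.deg (α.map (basisLetter hb)) = totalDeg deg α := by
  simp [totalDeg, Function.comp_def]

/-- The projection to degree `n` fixes `x` and kills the basis vectors of other degrees. -/
lemma mem_span_of_mem [DirectSum.Decomposition 𝒱] (hb : ∀ a, b a ∈ 𝒱 (deg a)) {n : ℤ} {x : V}
    (hx : x ∈ 𝒱 n) : x ∈ Submodule.span K (b '' {a | deg a = n}) := by
  have h : ∀ y : V, (DirectSum.decompose 𝒱 y n : V) ∈ Submodule.span K (b '' {a | deg a = n}) := by
    intro y
    induction b.mem_span y using Submodule.span_induction with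
    | mem y hy =>
      obtain ⟨a, rfl⟩ := hy
      by_cases ha : deg a = n
      · subst ha
        rw [DirectSum.decompose_of_mem_same _ (hb a)]
        exact Submodule.subset_span ⟨a, rfl, rfl⟩
      · rw [DirectSum.decompose_of_mem_ne _ (hb a) ha]
        exact zero_mem _
    | zero => simp
    | add y z _ _ hy hz => simpa [DirectSum.decompose_add] using add_mem hy hz
    | smul c y _ hy => simpa [DirectSum.decompose_smul, DirectSum.smul_apply] using Submodule.smul_mem _ c hy
  simpa [DirectSum.decompose_of_mem_same _ hx] using h x

lemma repr_eq_zero_of_mem [DirectSum.Decomposition 𝒱] (hb : ∀ a, b a ∈ 𝒱 (deg a)) {n : ℤ} {x : V}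
    (hx : x ∈ 𝒱 n) {a : ι} (ha : deg a ≠ n) : b.repr x a = 0 := by
  classical
  have hx' := mem_span_of_mem hb hx
  clear hx
  induction hx' using Submodule.span_induction with
  | mem y hy =>
    obtain ⟨a', h, rfl⟩ := hy
    rw [b.repr_self, Finsupp.single_apply, if_neg]
    rintro rfl
    exact ha h
  | zero => simp
  | add y z _ _ hy hz => simp [*]
  | smul c y _ hy => simp [*]

/-- A letterwise linear function that vanishes on words of basis vectors vanishes. -/
lemma LetterLinear.eq_zero_of_basis [DirectSum.Decomposition 𝒱] (hb : ∀ a, b a ∈ 𝒱 (deg a))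
    {g : List (Homog 𝒱) → M} (hg : LetterLinear g) (h : ∀ α : List ι, g (α.map (basisLetter hb)) = 0)
    (l : List (Homog 𝒱)) : g l = 0 := by
  -- The letters are expanded in the basis from left to right; the prefix `α` records those already
  -- replaced by basis vectors.
  suffices ∀ α : List ι, g (α.map (basisLetter hb) ++ l) = 0 from this []
  induction l with
  | nil => simpa using h
  | cons x l ih =>
    intro α
    obtain ⟨n, x, hx⟩ := x
    have hle : Submodule.span K (b '' {a | deg a = n}) ≤ 𝒱 n := by
      rw [Submodule.span_le]
      rintro _ ⟨a, rfl, rfl⟩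
      exact hb a
    induction mem_span_of_mem hb hx using Submodule.span_induction with
    | mem y hy =>
      obtain ⟨a, rfl, rfl⟩ := hy
      simpa [basisLetter] using ih (α ++ [a])
    | zero => 
      have := hg.map_smul (α.map (basisLetter hb)) l n 0 ⟨0, hx⟩
      rwa [zero_smul, zero_smul] at this
    | add y z hy' hz' hy hz =>
      have := hg.map_add (α.map (basisLetter hb)) l n ⟨y, hle hy'⟩ ⟨z, hle hz'⟩
      rwa [hy, hz, add_zero] at this
    | smul c y hy' hy =>
      have := hg.map_smul (α.map (basisLetter hb)) l n c ⟨y, hle hy'⟩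
      rwa [hy, smul_zero] at this

lemma Operations.isPreLieSqInfinity_iff [DirectSum.Decomposition 𝒱] (hb : ∀ a, b a ∈ 𝒱 (deg a)) :
    m.IsPreLieSqInfinity ↔ ∀ α β : List ι,
      m.relSymm (α.map (basisLetter hb)) (β.map (basisLetter hb)) -
        m.relSkew (α.map (basisLetter hb)) (β.map (basisLetter hb)) = 0 := by
  refine ⟨fun h α β => h _ _, fun h v w => ?_⟩
  refine LetterLinear.eq_zero_of_basis hb
    ((m.letterLinear_relSymm_left w).sub (m.letterLinear_relSkew_left w)) (fun α => ?_) v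
  exact LetterLinear.eq_zero_of_basis hb
    ((m.letterLinear_relSymm_right _).sub (m.letterLinear_relSkew_right _)) (fun β => h α β) w

end Basis

end Multilinearity

/-! ### Exponents of the signs and their behaviour under unshuffles -/

section Exponents

variable {ι : Type*} (deg : ι → ℤ)

/-- The exponent `∑_{i < j} |a_i| |a_j|` of a word. -/
def crossExp : List ι → ℤ
  | [] => 0
  | a :: l => deg a * totalDeg deg l + crossExp l

/-- The exponent `∑_{i < j} (|b_i| + 1) |b_j|` of a word. -/
def skewCrossExp : List ι → ℤ
  | [] => 0
  | a :: l => (deg a + 1) * totalDeg deg l + skewCrossExp l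

lemma sum_Iic_succ {n : ℕ} (f : Fin (n + 1) → ℤ) (i : Fin n) :
    ∑ j ∈ Finset.Iic i.succ, f j = f 0 + ∑ j ∈ Finset.Iic i, f j.succ := by
  have h : ∀ {m : ℕ} (k : Fin m) (g : Fin m → ℤ),
      ∑ j ∈ Finset.Iic k, g j = ∑ j, if j ≤ k then g j else 0 := by
    intro m k g
    rw [← Finset.sum_filter]
    congr 1
    ext j
    simp
  rw [h, h, Fin.sum_univ_succ]
  simp

lemma sum_Ioi_succ {n : ℕ} (f : Fin (n + 1) → ℤ) (i : Fin n) :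
    ∑ j ∈ Finset.Ioi i.succ, f j = ∑ j ∈ Finset.Ioi i, f j.succ := by
  have h : ∀ {m : ℕ} (k : Fin m) (g : Fin m → ℤ),
      ∑ j ∈ Finset.Ioi k, g j = ∑ j, if k < j then g j else 0 := by
    intro m k g
    rw [← Finset.sum_filter]
    congr 1
    ext j
    simp
  rw [h, h, Fin.sum_univ_succ]
  simp

lemma sum_Ioi_zero {n : ℕ} (f : Fin (n + 1) → ℤ) :
    ∑ j ∈ Finset.Ioi 0, f j = ∑ j : Fin n, f j.succ := by
  rw [Fin.Ioi_zero_eq_map]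
  simp

lemma totalDeg_eq_sum_get (l : List ι) : totalDeg deg l = ∑ i : Fin l.length, deg (l.get i) := by
  induction l with
  | nil => simp
  | cons a l ih =>
    rw [totalDeg_cons, ih]
    exact (Fin.sum_univ_succ (n := l.length) fun i => deg ((a :: l).get i)).symm

/-- The diagonal terms `|a_i|²` equal `|a_i|` modulo 2, which turns `z` into `z + 1`; the terms with
`j < i` form `crossExp`. -/
lemma sum_get_mul_Iic (α : List ι) (z : ℤ) :
    ((∑ i : Fin α.length, deg (α.get i) * (z + ∑ j ∈ Finset.Iic i, deg (α.get j)) : ℤ) : ZMod 2) =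
      (z + 1) * totalDeg deg α + crossExp deg α := by
  induction α generalizing z with
  | nil => simp [crossExp]
  | cons a l ih =>
    have h : (∑ i : Fin (a :: l).length,
        deg ((a :: l).get i) * (z + ∑ j ∈ Finset.Iic i, deg ((a :: l).get j))) =
        deg a * (z + deg a) +
          ∑ i : Fin l.length, deg (l.get i) * (z + deg a + ∑ j ∈ Finset.Iic i, deg (l.get j)) := by
      refine (Fin.sum_univ_succ (n := l.length) _).trans ?_
      congr 1
      · have : Finset.Iic (0 : Fin (l.length + 1)) = {0} := by ext j; simp
        change deg a * (z + ∑ j ∈ Finset.Iic (0 : Fin (l.length + 1)), deg ((a :: l).get j)) = _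
        rw [this, Finset.sum_singleton]
        rfl
      · refine Finset.sum_congr rfl fun i _ => ?_
        have := sum_Iic_succ (n := l.length) (fun j => deg ((a :: l).get j)) i
        exact congrArg (deg (l.get i) * ·) ((congrArg (z + ·) this).trans (add_assoc _ _ _).symm)
    rw [h, Int.cast_add, ih]
    have := zmod_two_mul_self (deg a : ZMod 2)
    simp only [totalDeg_cons, crossExp]
    push_cast
    grind

lemma sum_get_mul_Ioi (β : List ι) :
    ∑ i : Fin β.length, (deg (β.get i) + 1) * ∑ j ∈ Finset.Ioi i, deg (β.get j) =
      skewCrossExp deg β := by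
  induction β with
  | nil => simp [skewCrossExp]
  | cons a l ih =>
    refine (Fin.sum_univ_succ (n := l.length) _).trans ?_
    rw [skewCrossExp, ← ih, totalDeg_eq_sum_get]
    congr 1
    · change (deg a + 1) * ∑ j ∈ Finset.Ioi (0 : Fin (l.length + 1)), deg ((a :: l).get j) = _
      exact congrArg ((deg a + 1) * ·)
        (sum_Ioi_zero (n := l.length) fun j => deg ((a :: l).get j))
    · refine Finset.sum_congr rfl fun i _ => ?_
      exact congrArg ((deg (l.get i) + 1) * ·)
        (sum_Ioi_succ (n := l.length) (fun j => deg ((a :: l).get j)) i)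

lemma epsilon_cast (α β : List ι) :
    (epsilon deg α β : ZMod 2) =
      (β.length + 1) * totalDeg deg α + crossExp deg α + skewCrossExp deg β := by
  rw [epsilon, sum_get_mul_Ioi, Int.cast_add, sum_get_mul_Iic]
  push_cast
  grind

lemma totalDeg_dtDeg (l : List ι) : totalDeg (dtDeg deg) l = totalDeg deg l + l.length := by
  induction l with
  | nil => simp
  | cons a l ih =>
    simp only [totalDeg_cons, ih, dtDeg, List.length_cons]
    push_cast
    ring

/-- Each pair of letters of `α` lies within `s`, within `t`, or across. As `|a| |b|` is symmetric,
the order in `α` does not affect the resulting decomposition of `crossExp`. -/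
lemma shSum_congr_cross {M : Type*} [AddCommMonoid M] {e : ι → ι → ℤ} (α : List ι)
    {F F' : List ι → List ι → ℤ → M}
    (h : ∀ s t n, totalDeg deg α = totalDeg deg s + totalDeg deg t →
      crossExp deg α = crossExp deg s + crossExp deg t + totalDeg deg s * totalDeg deg t →
      F s t n = F' s t n) : shSum e α F = shSum e α F' := by
  refine shSum_congr_of_rel (fun α s t n n' => n = n' ∧
    totalDeg deg α = totalDeg deg s + totalDeg deg t ∧
    crossExp deg α = crossExp deg s + crossExp deg t + totalDeg deg s * totalDeg deg t)
    (by simp [crossExp]) ?_ ?_ α F F' ?_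
  · rintro a l s t n _ ⟨rfl, h1, h2⟩
    refine ⟨rfl, by rw [totalDeg_cons, totalDeg_cons, h1, add_assoc], ?_⟩
    simp only [crossExp, h1, h2, totalDeg_cons]
    ring
  · rintro a l s t n _ ⟨rfl, h1, h2⟩
    refine ⟨rfl, by rw [totalDeg_cons, totalDeg_cons, h1, add_left_comm], ?_⟩
    simp only [crossExp, h1, h2, totalDeg_cons]
    ring
  · rintro s t n _ ⟨rfl, h1, h2⟩
    exact h s t n h1 h2

/-- The exponents of the rearrangement of a word of `dt`'s and of a word of antisymmetric arguments
differ by the change of `skewCrossExp`. -/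
lemma shSum_congr_skew {M : Type*} [AddCommMonoid M] (β : List ι)
    {F F' : List ι → List ι → ℤ → M}
    (h : ∀ u v (n n' : ℤ), totalDeg deg β = totalDeg deg u + totalDeg deg v →
      β.length = u.length + v.length →
      (n : ZMod 2) = n' + skewCrossExp deg β + skewCrossExp deg u + skewCrossExp deg v +
        (totalDeg deg u + u.length) * totalDeg deg v →
      F u v n = F' u v n') :
    shSum (symExp (dtDeg deg)) β F = shSum (skewExp deg) β F' := by
  have hskew : ∀ (a : ι) (l : List ι),
      (l.map (skewExp deg a)).sum = deg a * totalDeg deg l + l.length := by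
    intro a l
    induction l with
    | nil => simp
    | cons b l ih =>
      simp only [List.map_cons, List.sum_cons, ih, skewExp, totalDeg_cons, List.length_cons]
      push_cast
      ring
  refine shSum_congr_of_rel (fun β u v n n' =>
    totalDeg deg β = totalDeg deg u + totalDeg deg v ∧ β.length = u.length + v.length ∧
      (n : ZMod 2) = n' + skewCrossExp deg β + skewCrossExp deg u + skewCrossExp deg v +
        (totalDeg deg u + u.length) * totalDeg deg v)
    (by simp [skewCrossExp]) ?_ ?_ β F F' ?_
  · rintro a l s t n n' ⟨h1, h2, h3⟩
    refine ⟨by rw [totalDeg_cons, totalDeg_cons, h1, add_assoc],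
      by simp only [List.length_cons, h2]; omega, ?_⟩
    simp only [skewCrossExp, h1, totalDeg_cons, List.length_cons, h3]
    push_cast
    grind
  · rintro a l s t n n' ⟨h1, h2, h3⟩
    refine ⟨by rw [totalDeg_cons, totalDeg_cons, h1, add_left_comm],
      by simp only [List.length_cons, h2]; omega, ?_⟩
    simp only [skewCrossExp, h1, totalDeg_cons, sum_map_symExp, hskew, totalDeg_dtDeg]
    push_cast
    rw [h3]
    simp only [dtDeg]
    push_cast
    grind
  · rintro s t n n' ⟨h1, h2, h3⟩
    exact h s t n n' h1 h2 h3

end Exponents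

/-! ### Coefficients of the structure equations as quadratic relations -/

section Coefficients

variable {K V ι : Type*} [Field K] [AddCommGroup V] [Module K V] {𝒱 : ℤ → Submodule K V}
  (deg : ι → ℤ) (b : Module.Basis ι K V) (m : Operations 𝒱)

/-- The vector-valued form `∑_{p ≥ 0} Γ_p`. -/
noncomputable def totalForm : VForm K ι := fun c α β =>
  sgn K (epsilon deg α β + deg c * totalDeg (dtDeg deg) β) *
    b.repr (evalOp m.μ (α.map b) (β.map b)) c

lemma gammaP_eq (p : ℕ) (c : ι) (α β : List ι) :
    gammaP deg b m p c α β = if β.length = p then totalForm deg b m c α β else 0 := rfl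

lemma eth_apply (c : ι) (α β : List ι) :
    eth deg b m c α β = if β = [] then totalForm deg b m c α β else 0 := by
  simp only [eth, gammaP_eq, List.length_eq_zero_iff]

lemma gamma_apply (c : ι) (α β : List ι) :
    gamma deg b m c α β = if β = [] then 0 else totalForm deg b m c α β := by
  simp only [gamma, gammaP_eq]
  rw [finsum_eq_single _ β.length]
  · cases β <;> simp
  · intro p hp
    simp [hp.symm]

lemma eth_add_gamma : eth deg b m + gamma deg b m = totalForm deg b m := by
  funext c α β
  simp only [Pi.add_apply, eth_apply, gamma_apply]
  split_ifs <;> simp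

lemma locFinite_totalForm : LocFinite (totalForm deg b m) := fun α β =>
  (b.repr (evalOp m.μ (α.map b) (β.map b))).hasFiniteSupport.subset
    (Function.support_mul_subset_right _ _)

variable {deg b m}

/-- Eliminates the degree of an output index from the sign of a nonzero term. -/
lemma deg_eq_of_repr_ne_zero [DirectSum.Decomposition 𝒱] (hb : ∀ a, b a ∈ 𝒱 (deg a))
    {c : ι} {α β : List ι} (h : b.repr (evalOp m.μ (α.map b) (β.map b)) c ≠ 0) :
    deg c = totalDeg deg α + totalDeg deg β + 1 - β.length := by
  by_contra hne
  refine h (repr_eq_zero_of_mem hb ?_ hne)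
  have := m.degree (α.map (basisLetter hb)) (β.map (basisLetter hb))
  simpa [totalDeg_map_basisLetter] using this

/-- The total degree is one: since `μ_{k,p}` has degree `1 - p`, each nonzero coefficient of `Q^a`
belongs to a monomial of the parity of `dt^a`. -/
lemma twist_totalForm [DirectSum.Decomposition 𝒱] (hb : ∀ a, b a ∈ 𝒱 (deg a)) (a : ι) (z : ℤ)
    (α β : List ι) : twist deg z (totalForm deg b m a) α β =
      sgn K (z * dtDeg deg a) * totalForm deg b m a α β := by
  by_cases h : b.repr (evalOp m.μ (α.map b) (β.map b)) a = 0
  · simp [twist, totalForm, h]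
  · simp only [twist]
    congr 1
    apply sgn_congr
    simp only [dtDeg, deg_eq_of_repr_ne_zero hb h, totalDeg_dtDeg]
    push_cast
    grind

lemma isDegOne_eth [DirectSum.Decomposition 𝒱] (hb : ∀ a, b a ∈ 𝒱 (deg a)) :
    IsDegOne deg (eth deg b m) := by
  constructor
  · refine fun α β => (locFinite_totalForm deg b m α β).subset fun a ha h => ha ?_
    simp only at h
    simp [eth_apply, h]
  · intro a z
    funext α β
    by_cases h : β = []
    · simpa [twist, eth_apply, h] using twist_totalForm hb a z α β
    · simp [twist, eth_apply, h]

lemma isDegOne_gamma [DirectSum.Decomposition 𝒱] (hb : ∀ a, b a ∈ 𝒱 (deg a)) :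
    IsDegOne deg (gamma deg b m) := by
  constructor
  · refine fun α β => (locFinite_totalForm deg b m α β).subset fun a ha h => ha ?_
    simp only at h
    simp [gamma_apply, h]
  · intro a z
    funext α β
    by_cases h : β = []
    · simp [twist, gamma_apply, h]
    · simpa [twist, gamma_apply, h] using twist_totalForm hb a z α β

lemma evalOp_append_singleton (v w : List (Homog 𝒱)) (x : Homog 𝒱) :
    evalOp m.μ (vecs (v ++ [x])) (vecs w) =
      sgn K (x.deg * totalDeg Homog.deg v) • evalOp m.μ (vecs (x :: v)) (vecs w) := by
  -- The symmetry of `m` exchanges neighbours inside a word, so the induction carries a prefix `u`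
  -- of letters already passed over.
  suffices ∀ u, evalOp m.μ (vecs (u ++ (v ++ [x]))) (vecs w) =
      sgn K (x.deg * totalDeg Homog.deg v) • evalOp m.μ (vecs (u ++ x :: v)) (vecs w) from this []
  induction v with
  | nil => simp
  | cons y v ih =>
    intro u
    have h := ih (u ++ [y])
    simp only [List.append_assoc, List.cons_append, List.nil_append] at h ⊢
    rw [h, m.symm, smul_smul, ← sgn_add]
    congr 2
    simp only [symExp, totalDeg_cons]
    ring

lemma evalOp_map_append_singleton (hb : ∀ a, b a ∈ 𝒱 (deg a)) (α β : List ι) (a : ι) :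
    evalOp m.μ (α.map b ++ [b a]) (β.map b) =
      sgn K (deg a * totalDeg deg α) • evalOp m.μ (b a :: α.map b) (β.map b) := by
  have := evalOp_append_singleton (m := m) (α.map (basisLetter hb)) (β.map (basisLetter hb))
    (basisLetter hb a)
  rw [vecs_append, totalDeg_map_basisLetter, ← List.map_cons] at this
  simp only [vecs_map_basisLetter, deg_basisLetter] at this
  exact this

/-- Here `x` will be the value of the inner operation: composition of operations becomes the
contraction over `a` that occurs in the derivations. -/
lemma repr_linear_eq_finsum (b : Module.Basis ι K V) {f : V → V} (hf : IsLinearMap K f) (x : V)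
    (c : ι) : b.repr (f x) c = ∑ᶠ a, b.repr x a * b.repr (f (b a)) c := by
  have h : b.repr (f x) c = (b.coord c ∘ₗ hf.mk' f) x := rfl
  rw [h]
  conv_lhs => rw [← b.linearCombination_repr x, Finsupp.linearCombination_apply, Finsupp.sum,
    map_sum]
  rw [finsum_eq_sum_of_support_subset (s := (b.repr x).support)]
  · simp
  · intro a ha
    simp only [Finset.mem_coe, Finsupp.mem_support_iff]
    intro h0
    simp [h0] at ha

lemma sgn_term {e e₁ e₂ d d₁ d₂ : ℤ} {r₁ r₂ : K}
    (h : ((e + e₁ + e₂ : ℤ) : ZMod 2) = ((d + d₁ + d₂ : ℤ) : ZMod 2)) :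
    sgn K e * (sgn K e₁ * r₁ * (sgn K e₂ * r₂)) =
      sgn K d * (sgn K d₁ * (r₁ * (sgn K d₂ * r₂))) := by
  have := sgn_congr K h
  simp only [sgn_add] at this
  linear_combination r₁ * r₂ * this

/-- The exponent of the sign that relates the coefficients of the structure equations to the
quadratic relations. -/
def structExp (deg : ι → ℤ) (α β : List ι) : ℤ :=
  crossExp deg α + skewCrossExp deg β + totalDeg deg α * totalDeg deg β + totalDeg deg β +
    β.length + 1

/-- The factor `Q^a` is the inner operation with output `e_a`, and `∂Q^c/∂t^a` is the outer one with
`e_a` as first symmetric argument. -/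
lemma vfAct_totalForm [DirectSum.Decomposition 𝒱] (hb : ∀ a, b a ∈ 𝒱 (deg a)) (c : ι)
    (α β : List ι) : vfAct deg (totalForm deg b m) (totalForm deg b m c) α β =
      sgn K (structExp deg α β) *
        b.repr (m.relSymm (α.map (basisLetter hb)) (β.map (basisLetter hb))) c := by
  have hfin : ∀ s u, (Function.support fun a => totalForm deg b m a s u).Finite :=
    locFinite_totalForm deg b m
  have hfin' : ∀ s t u v (k : ℤ), (Function.support fun a =>
      sgn K k * (totalForm deg b m a s u * partialT a (totalForm deg b m c) t v)).Finite :=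
    fun s t u v k => (hfin s u).subset <| (Function.support_mul_subset_right _ _).trans
      (Function.support_mul_subset_left _ _)
  let ψ : V →+ K :=
    (AddMonoidHom.mulLeft (sgn K (structExp deg α β))).comp (b.coord c).toAddMonoidHom
  change _ = ψ _
  rw [m.relSymm_eq, shSum_map, map_shSum]
  simp only [vfAct, Form.mul_apply]
  -- The first part of `α` belongs to the inner operation in the product of forms and to the outer
  -- one in `relSymm`; the parts of `β` already agree. Hence the swap for `α` only.
  rw [finsum_shSum _ _ _ fun s t n => finite_support_shSum _ _ _ fun u v k => hfin' _ _ _ _ _,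
    shSum_swap]
  refine shSum_congr_cross deg α fun s t n hα hcross => ?_
  rw [finsum_shSum _ _ _ fun u v k => hfin' _ _ _ _ _, shSum_map, map_shSum]
  refine shSum_congr_skew deg β fun u v k k' hβ hlen hk => ?_
  change _ = sgn K (structExp deg α β) * b.repr (_ • _) c
  simp only [vecs_map_basisLetter, List.length_map, totalDeg_map_basisLetter, map_smul,
    Finsupp.smul_apply, smul_eq_mul]
  rw [repr_linear_eq_finsum b (evalOp_isLinearMap_left m.μ (s.map b) [] (v.map b)), mul_finsum,
    mul_finsum]
  refine finsum_congr fun a => ?_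
  rw [evalOp_map_append_singleton hb, map_smul, Finsupp.smul_apply, smul_eq_mul]
  simp only [partialT, totalForm, List.map_cons]
  -- If a structure constant vanishes, both sides do. Otherwise the degrees of `a` and `c` are
  -- determined, and only exponents modulo 2 have to be compared.
  by_cases h1 : b.repr (evalOp m.μ (t.map b) (u.map b)) a = 0
  · simp [h1]
  by_cases h2 : b.repr (evalOp m.μ (b a :: s.map b) (v.map b)) c = 0
  · simp [h2]
  apply sgn_term
  have ha := congrArg (Int.cast : ℤ → ZMod 2) (deg_eq_of_repr_ne_zero hb h1)
  have hc := congrArg (Int.cast : ℤ → ZMod 2)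
    (deg_eq_of_repr_ne_zero hb (α := a :: s) (by simpa using h2))
  simp only [structExp, hα, hcross, hβ, hlen, totalDeg_dtDeg]
  simp only [totalDeg_cons] at hc
  push_cast at ha hc ⊢
  simp only [epsilon_cast, crossExp, totalDeg_cons, hk, ha, hc]
  push_cast
  simp only [ha]
  -- What remains is a polynomial identity over `ZMod 2`, decided with the help of `x * x = x`.
  generalize (totalDeg deg s : ZMod 2) = S
  generalize (totalDeg deg t : ZMod 2) = T
  generalize (totalDeg deg u : ZMod 2) = U
  generalize (totalDeg deg v : ZMod 2) = W
  generalize (u.length : ZMod 2) = p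
  generalize (v.length : ZMod 2) = q
  have := zmod_two_mul_self S
  have := zmod_two_mul_self T
  have := zmod_two_mul_self U
  have := zmod_two_mul_self W
  have := zmod_two_mul_self p
  have := zmod_two_mul_self q
  grind

/-- The single letter in `q` is the `dt` created by `d`; it reappears as a `t`-argument of `f`. This
matches the one-letter word `w₁` of `relSkew`. -/
lemma deRham_eq_shSum (f : Form K ι) (α β : List ι) :
    deRham deg f α β = shSum (symExp (dtDeg deg)) β fun q q' j =>
      if q.length = 1 then
        sgn K (j + totalDeg (dtDeg deg) q * totalDeg deg α) * f (q ++ α) q'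
      else 0 := by
  have h : ∀ a, Form.mul deg (dcoord a) (partialT a f) α β =
      shSum (symExp (dtDeg deg)) β fun u v k =>
        sgn K (k + totalDeg (dtDeg deg) u * totalDeg deg α) *
          (dcoord a [] u * partialT a f α v) := by
    intro a
    rw [Form.mul_apply, shSum_of_left_nil]
    · simp only [zero_add]
    · intro s t n hs
      exact shSum_eq_zero _ _ _ fun u v k => by simp [dcoord, hs]
  have hd : ∀ (a : ι) (u : List ι), u ≠ [a] → (dcoord a : Form K ι) [] u = 0 := by
    intro a u hu
    simp [dcoord, hu]
  simp only [deRham, h]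
  rw [finsum_shSum]
  · congr 1
    funext u v k
    rcases u with _ | ⟨x, _ | ⟨y, u⟩⟩
    · simp [dcoord]
    · rw [finsum_eq_single _ x]
      · simp [dcoord, partialT]
      · intro a ha
        simp [dcoord, ha.symm]
    · simp [dcoord]
  · intro u v k
    refine Set.Subsingleton.finite fun a ha a' ha' => ?_
    have h1 : u = [a] := by
      by_contra hne
      exact ha (by simp [hd _ _ hne])
    have h2 : u = [a'] := by
      by_contra hne
      exact ha' (by simp [hd _ _ hne])
    rw [h1] at h2
    simpa using h2

lemma sgn_term' {e d₁ e₁ d₂ e₂ f f₁ f₂ : ℤ} {r₁ r₂ : K}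
    (h : ((e + (d₁ + e₁) + (d₂ + e₂) : ℤ) : ZMod 2) = ((f + f₁ + f₂ : ℤ) : ZMod 2)) :
    sgn K e * (sgn K d₁ * (sgn K e₁ * r₁) * (sgn K d₂ * (sgn K e₂ * r₂))) =
      sgn K f * (sgn K f₁ * (sgn K f₂ * (r₁ * r₂))) := by
  have := sgn_congr K h
  simp only [sgn_add] at this
  linear_combination r₁ * r₂ * this

/-- In `dQ^a` one letter of `β` becomes a symmetric argument of the inner operation, and `∂/∂(dt^a)`
puts the output `e_a` into the first antisymmetric slot of the outer one. -/
lemma insertionD_totalForm [DirectSum.Decomposition 𝒱] (hb : ∀ a, b a ∈ 𝒱 (deg a)) (c : ι)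
    (α β : List ι) : insertionD deg (totalForm deg b m) (totalForm deg b m c) α β =
      sgn K (structExp deg α β) *
        b.repr (m.relSkew (α.map (basisLetter hb)) (β.map (basisLetter hb))) c := by
  have hfin : ∀ s u, (Function.support fun a => totalForm deg b m a s u).Finite :=
    locFinite_totalForm deg b m
  have hfin' : ∀ s t u v (k : ℤ), (Function.support fun a =>
      sgn K k * (deRham deg (totalForm deg b m a) s u *
        partialDt deg a (totalForm deg b m c) t v)).Finite :=
    fun s t u v k => (locFinite_deRham deg hfin s u).subset <|
      (Function.support_mul_subset_right _ _).trans (Function.support_mul_subset_left _ _)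
  let ψ : V →+ K :=
    (AddMonoidHom.mulLeft (sgn K (structExp deg α β))).comp (b.coord c).toAddMonoidHom
  change _ = ψ _
  rw [m.relSkew_eq, shSum_map, map_shSum]
  simp only [insertionD, insertion, Form.mul_apply]
  rw [finsum_shSum _ _ _ fun s t n => finite_support_shSum _ _ _ fun u v k => hfin' _ _ _ _ _,
    shSum_swap]
  refine shSum_congr_cross deg α fun s t n hα hcross => ?_
  rw [finsum_shSum _ _ _ fun u v k => hfin' _ _ _ _ _, shSum_map, map_shSum]
  refine shSum_congr_skew deg β fun u v k k' hβ hlen hk => ?_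
  simp only [deRham_eq_shSum, shSum_mul, mul_shSum]
  rw [finsum_shSum, shSum_map, map_shSum]
  swap
  · intro q q' j
    refine (hfin (q ++ t) q').subset fun a ha h0 => ha ?_
    simp only at h0
    simp [h0]
  refine shSum_congr_skew deg u fun q q' j j' hu hulen hj => ?_
  rw [List.length_map]
  by_cases hq : q.length = 1
  swap
  · simp [hq]
  obtain ⟨x, rfl⟩ := List.length_eq_one_iff.1 hq
  simp only [hq, if_true]
  change _ = sgn K (structExp deg α β) * b.repr (_ • _) c
  simp only [vecs_map_basisLetter, List.length_map, totalDeg_map_basisLetter, map_smul,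
    Finsupp.smul_apply, smul_eq_mul, List.map_cons, List.map_nil]
  have hlin : IsLinearMap K fun x => evalOp m.μ (s.map b) (x :: v.map b) :=
    evalOp_isLinearMap_right m.μ (s.map b) [] (v.map b)
  have hx : vecs [basisLetter hb x] = [b x] := rfl
  rw [hx, evalOp_map_append_singleton hb, hlin.map_smul, map_smul, Finsupp.smul_apply,
    smul_eq_mul, repr_linear_eq_finsum b hlin, mul_finsum, mul_finsum, mul_finsum]
  refine finsum_congr fun a => ?_
  simp only [partialDt, totalForm, List.map_cons, List.cons_append, List.nil_append]
  by_cases h1 : b.repr (evalOp m.μ (b x :: t.map b) (q'.map b)) a = 0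
  · simp [h1]
  by_cases h2 : b.repr (evalOp m.μ (s.map b) (b a :: v.map b)) c = 0
  · simp [h2]
  apply sgn_term'
  have ha := congrArg (Int.cast : ℤ → ZMod 2)
    (deg_eq_of_repr_ne_zero hb (α := x :: t) (by simpa using h1))
  have hc := congrArg (Int.cast : ℤ → ZMod 2)
    (deg_eq_of_repr_ne_zero hb (β := a :: v) (by simpa using h2))
  simp only [structExp, hα, hcross, hβ, hlen, hu, hulen, totalDeg_dtDeg]
  simp only [totalDeg_cons, List.length_cons] at hc ha
  push_cast at ha hc ⊢
  rw [hk, hj]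
  simp only [epsilon_cast, crossExp, skewCrossExp, totalDeg_cons, totalDeg_nil, hu,
    hulen, List.length_cons, List.length_nil, dtDeg]
  push_cast
  rw [hc, ha]
  generalize (totalDeg deg s : ZMod 2) = S
  generalize (totalDeg deg t : ZMod 2) = T
  generalize (totalDeg deg q' : ZMod 2) = U
  generalize (totalDeg deg v : ZMod 2) = W
  generalize (q'.length : ZMod 2) = p
  generalize (v.length : ZMod 2) = q
  generalize (deg x : ZMod 2) = X
  have := zmod_two_mul_self S
  have := zmod_two_mul_self T
  have := zmod_two_mul_self U
  have := zmod_two_mul_self W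
  have := zmod_two_mul_self p
  have := zmod_two_mul_self q
  have := zmod_two_mul_self X
  grind

lemma structure_equations_iff_isPreLieSqInfinity [CharZero K] [DirectSum.Decomposition 𝒱]
    (hb : ∀ a, b a ∈ 𝒱 (deg a)) :
    m.IsPreLieSqInfinity ↔
      vfBracket deg 1 1 (eth deg b m) (eth deg b m) = 0 ∧
      lieDerivative deg 1 1 (eth deg b m) (gamma deg b m)
        + (1 / 2 : K) • fnBracket deg 1 1 (gamma deg b m) (gamma deg b m) = 0 := by
  rw [structure_equations_iff (isDegOne_eth hb) (isDegOne_gamma hb)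
    (fun c α β h => by rw [eth_apply, if_neg h]) (fun c α => by rw [gamma_apply, if_pos rfl]),
    m.isPreLieSqInfinity_iff hb, eth_add_gamma]
  have h : ∀ c α β, (vfAct deg (totalForm deg b m) (totalForm deg b m c) -
      insertionD deg (totalForm deg b m) (totalForm deg b m c)) α β =
      sgn K (structExp deg α β) * b.repr
        (m.relSymm (α.map (basisLetter hb)) (β.map (basisLetter hb)) -
          m.relSkew (α.map (basisLetter hb)) (β.map (basisLetter hb))) c := by
    intro c α β
    rw [Pi.sub_apply, Pi.sub_apply, vfAct_totalForm hb, insertionD_totalForm hb, map_sub,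
      Finsupp.sub_apply, mul_sub]
  constructor
  · intro hrel c
    funext α β
    rw [h, hrel]
    simp
  · intro hq α β
    apply b.repr.injective
    ext c
    have := h c α β
    rw [hq, Pi.zero_apply, Pi.zero_apply, eq_comm, mul_eq_zero] at this
    simpa using this.resolve_left (sgn_ne_zero K _)

end Coefficients

/-! ### The Nijenhuis tensor over a commutative ring with derivations -/

section TensorialityOfNijenhuis

variable {R ι : Type*} [CommRing R] [Fintype ι] (D : ι → Derivation ℤ R R)

/-- The derivation along the vector field with components `X`. -/
def derivAlong (X : ι → R) : Derivation ℤ R R := ∑ a, X a • D a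

lemma derivAlong_apply (X : ι → R) (f : R) : derivAlong D X f = ∑ a, X a * D a f := by
  rw [derivAlong, ← Derivation.coeFnAddMonoidHom_apply, map_sum, Finset.sum_apply]
  simp

/-- The components of the bracket of vector fields. -/
def compBracket (X Y : ι → R) (c : ι) : R := derivAlong D X (Y c) - derivAlong D Y (X c)

/-- The components of the value of an endomorphism field on a vector field. -/
def compApply (J : ι → ι → R) (X : ι → R) (c : ι) : R := ∑ a, X a * J c a

/-- The components of the Nijenhuis tensor of an endomorphism field. -/
def nijenhuisCoeff (J : ι → ι → R) (c i j : ι) : R :=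
  ∑ a, (J a i * D a (J c j) - J a j * D a (J c i)) - ∑ a, (D i (J a j) - D j (J a i)) * J c a

/-- After the product rule all terms with derivatives of `X` or `Y` cancel, and only those in which
a derivation hits `J` survive. -/
lemma nijenhuis_eq_sum (J : ι → ι → R) (X Y : ι → R) (c : ι) :
    compBracket D (compApply J X) (compApply J Y) c
      + compApply J (compApply J (compBracket D X Y)) c
      - compApply J (compBracket D X (compApply J Y)) c
      - compApply J (compBracket D (compApply J X) Y) c =
    ∑ i, ∑ j, X i * Y j * nijenhuisCoeff D J c i j := by
  -- The product rule `D_X(JY) = J(D_X Y) + (D_X J) Y`.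
  have h1 : ∀ (X Y : ι → R) c, derivAlong D X (compApply J Y c) =
      compApply J (fun a => derivAlong D X (Y a)) c + ∑ a, Y a * derivAlong D X (J c a) := by
    intro X Y c
    simp only [compApply, map_sum, Derivation.leibniz, smul_eq_mul, Finset.sum_add_distrib]
    rw [add_comm]
    simp only [mul_comm]
  have hsub : ∀ (Z W : ι → R) c, compApply J (fun a => Z a - W a) c =
      compApply J Z c - compApply J W c := by
    intro Z W c
    simp only [compApply, sub_mul, Finset.sum_sub_distrib]
  have hadd : ∀ (Z W : ι → R) c, compApply J (fun a => Z a + W a) c =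
      compApply J Z c + compApply J W c := by
    intro Z W c
    simp only [compApply, add_mul, Finset.sum_add_distrib]
  have h2 : ∀ (X Y : ι → R), compApply J (compBracket D X Y) = fun c =>
      compApply J (fun a => derivAlong D X (Y a)) c -
        compApply J (fun a => derivAlong D Y (X a)) c := by
    intro X Y
    funext c
    exact hsub _ _ c
  have h3 : ∀ (X Y : ι → R), ∑ a, Y a * derivAlong D (compApply J X) (J c a) =
      ∑ i, ∑ j, X i * Y j * ∑ a, J a i * D a (J c j) := by
    intro X Y
    rw [Finset.sum_comm]
    refine Finset.sum_congr rfl fun j _ => ?_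
    simp only [derivAlong_apply, compApply, Finset.sum_mul, Finset.mul_sum]
    rw [Finset.sum_comm]
    exact Finset.sum_congr rfl fun i _ => Finset.sum_congr rfl fun a _ => by ring
  have h4 : ∀ (X Y : ι → R), compApply J (fun b => ∑ a, Y a * derivAlong D X (J b a)) c =
      ∑ i, ∑ j, X i * Y j * ∑ a, D i (J a j) * J c a := by
    intro X Y
    simp only [derivAlong_apply, compApply, Finset.sum_mul, Finset.mul_sum]
    rw [Finset.sum_comm' (t' := Finset.univ) (s' := fun _ => Finset.univ) (by simp)]
    rw [Finset.sum_congr rfl fun j _ => Finset.sum_comm]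
    rw [Finset.sum_comm]
    exact Finset.sum_congr rfl fun i _ => Finset.sum_congr rfl fun j _ =>
      Finset.sum_congr rfl fun a _ => by ring
  have h5 : ∑ i, ∑ j, X i * Y j * nijenhuisCoeff D J c i j =
      (∑ i, ∑ j, X i * Y j * ∑ a, J a i * D a (J c j))
      - (∑ i, ∑ j, Y i * X j * ∑ a, J a i * D a (J c j))
      - (∑ i, ∑ j, X i * Y j * ∑ a, D i (J a j) * J c a)
      + ∑ i, ∑ j, Y i * X j * ∑ a, D i (J a j) * J c a := by
    rw [Finset.sum_comm (f := fun i j => Y i * X j * ∑ a, J a i * D a (J c j)),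
      Finset.sum_comm (f := fun i j => Y i * X j * ∑ a, D i (J a j) * J c a)]
    simp only [← Finset.sum_sub_distrib, ← Finset.sum_add_distrib]
    refine Finset.sum_congr rfl fun i _ => Finset.sum_congr rfl fun j _ => ?_
    simp only [nijenhuisCoeff, sub_mul, Finset.sum_sub_distrib]
    ring
  rw [h5, ← h3, ← h3, ← h4, ← h4]
  simp only [h2, hsub, compBracket, h1, hadd]
  ring

end TensorialityOfNijenhuis

/-! ### Formal functions in degree zero -/

section ShuffleAlgebra

/-- The algebra of formal functions in degree zero, with the shuffle product of the coefficients. -/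
def ShuffleAlgebra (K ι : Type*) := List ι → K

namespace ShuffleAlgebra

variable {K ι : Type*} [Field K]

instance : AddCommGroup (ShuffleAlgebra K ι) := inferInstanceAs (AddCommGroup (List ι → K))

noncomputable instance : Mul (ShuffleAlgebra K ι) :=
  ⟨fun f g α => shSum (fun _ _ => 0) α fun s t _ => f s * g t⟩

open Classical in
noncomputable instance : One (ShuffleAlgebra K ι) := ⟨fun α => if α = [] then 1 else 0⟩

lemma mul_apply (f g : ShuffleAlgebra K ι) (α : List ι) :
    (f * g) α = shSum (fun _ _ => 0) α fun s t _ => f s * g t := rfl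

open Classical in
lemma one_apply (α : List ι) : (1 : ShuffleAlgebra K ι) α = if α = [] then 1 else 0 := rfl

lemma add_apply (f g : ShuffleAlgebra K ι) (α : List ι) : (f + g) α = f α + g α := rfl

lemma zero_apply (α : List ι) : (0 : ShuffleAlgebra K ι) α = 0 := rfl

/-- The partial derivative `∂/∂t^a`. -/
def shift (a : ι) (f : ShuffleAlgebra K ι) : ShuffleAlgebra K ι := fun α => f (a :: α)

lemma mul_nil (f g : ShuffleAlgebra K ι) : (f * g) [] = f [] * g [] := by
  rw [mul_apply, shSum_nil]

/-- With `mul_nil` this determines the product recursively, so commutativity and associativity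
follow by induction on the word from the Leibniz rule. -/
lemma mul_cons (f g : ShuffleAlgebra K ι) (a : ι) (α : List ι) :
    (f * g) (a :: α) = (shift a f * g) α + (f * shift a g) α := by
  rw [mul_apply, shSum_cons']
  rfl

protected lemma right_distrib (f g h : ShuffleAlgebra K ι) : (f + g) * h = f * h + g * h := by
  funext α
  simp only [mul_apply, add_apply, add_mul, shSum_add]

protected lemma left_distrib (f g h : ShuffleAlgebra K ι) : f * (g + h) = f * g + f * h := by
  funext α
  simp only [mul_apply, add_apply, mul_add, shSum_add]

protected lemma mul_comm (f g : ShuffleAlgebra K ι) : f * g = g * f := by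
  funext α
  induction α generalizing f g with
  | nil => simp only [mul_nil, _root_.mul_comm]
  | cons a α ih => rw [mul_cons, mul_cons, ih, ih f, add_comm]

lemma shift_mul (a : ι) (f g : ShuffleAlgebra K ι) :
    shift a (f * g) = shift a f * g + f * shift a g := by
  funext α
  exact mul_cons f g a α

protected lemma mul_assoc (f g h : ShuffleAlgebra K ι) : f * g * h = f * (g * h) := by
  funext α
  induction α generalizing f g h with
  | nil => simp only [mul_nil, _root_.mul_assoc]
  | cons a α ih =>
    simp only [mul_cons, shift_mul, ShuffleAlgebra.right_distrib, ShuffleAlgebra.left_distrib,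
      add_apply, ih, add_assoc]

protected lemma one_mul (f : ShuffleAlgebra K ι) : 1 * f = f := by
  funext α
  rw [mul_apply, shSum_of_left_nil]
  · simp [one_apply]
  · intro s t n hs
    simp [one_apply, hs]

noncomputable instance : CommRing (ShuffleAlgebra K ι) where
  __ := (inferInstance : AddCommGroup (ShuffleAlgebra K ι))
  left_distrib := ShuffleAlgebra.left_distrib
  right_distrib := ShuffleAlgebra.right_distrib
  zero_mul f := by
    funext α
    simp [mul_apply, zero_apply, shSum_eq_zero]
  mul_zero f := by
    funext α
    simp [mul_apply, zero_apply, shSum_eq_zero]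
  mul_assoc := ShuffleAlgebra.mul_assoc
  one_mul := ShuffleAlgebra.one_mul
  mul_one f := by rw [ShuffleAlgebra.mul_comm, ShuffleAlgebra.one_mul]
  mul_comm := ShuffleAlgebra.mul_comm

/-- The partial derivative `∂/∂t^a` as a derivation. -/
noncomputable def partialDeriv (a : ι) :
    Derivation ℤ (ShuffleAlgebra K ι) (ShuffleAlgebra K ι) :=
  Derivation.mk' (AddMonoidHom.toIntLinearMap
    { toFun := shift (K := K) a, map_zero' := rfl, map_add' := fun _ _ => rfl }) fun f g => by
      change shift a (f * g) = f * shift a g + g * shift a f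
      rw [shift_mul, _root_.mul_comm g, add_comm]

lemma partialDeriv_apply (a : ι) (f : ShuffleAlgebra K ι) (α : List ι) :
    partialDeriv a f α = f (a :: α) := rfl

open Classical in
/-- A formal function in degree zero as a form. -/
noncomputable def toForm (f : ShuffleAlgebra K ι) : Form K ι := fun α β =>
  if β = [] then f α else 0

lemma toForm_nil (f : ShuffleAlgebra K ι) (α : List ι) : toForm f α [] = f α := if_pos rfl

lemma toForm_of_ne (f : ShuffleAlgebra K ι) (α : List ι) {β : List ι} (h : β ≠ []) :
    toForm f α β = 0 := if_neg h

lemma toForm_injective : Function.Injective (toForm (K := K) (ι := ι)) := fun f g h => by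
  funext α
  rw [← toForm_nil f, h, toForm_nil]

lemma toForm_sub (f g : ShuffleAlgebra K ι) : toForm (f - g) = toForm f - toForm g := by
  funext α β
  by_cases h : β = []
  · subst h
    simp only [toForm_nil, Pi.sub_apply]
    rfl
  · simp [toForm_of_ne _ _ h]

lemma toForm_add (f g : ShuffleAlgebra K ι) : toForm (f + g) = toForm f + toForm g := by
  funext α β
  by_cases h : β = []
  · subst h
    simp only [toForm_nil, Pi.add_apply]
    rfl
  · simp [toForm_of_ne _ _ h]

lemma toForm_zero : toForm (0 : ShuffleAlgebra K ι) = 0 := by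
  simpa using toForm_sub (0 : ShuffleAlgebra K ι) 0

lemma toForm_sum [Fintype ι] (f : ι → ShuffleAlgebra K ι) (α β : List ι) :
    ∑ᶠ a, toForm (f a) α β = toForm (∑ a, f a) α β := by
  rw [finsum_eq_sum_of_fintype]
  let φ : ShuffleAlgebra K ι →+ Form K ι :=
    { toFun := toForm, map_zero' := toForm_zero, map_add' := toForm_add }
  have := map_sum φ f Finset.univ
  change toForm (∑ a, f a) = ∑ a, toForm (f a) at this
  rw [this]
  simp only [Finset.sum_apply]

lemma shSum_symExp_zero {M : Type*} [AddCommMonoid M] (α : List ι)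
    (F : List ι → List ι → ℤ → M) :
    shSum (symExp (0 : ι → ℤ)) α F = shSum (fun _ _ => 0) α fun s t _ => F s t 0 := by
  refine shSum_congr_of_rel (fun _ _ _ n _ => n = 0) rfl (fun _ _ _ _ _ _ h => h) ?_ α _ _ ?_
  · rintro a l s t n n' rfl
    simp [sum_map_symExp]
  · rintro s t n n' rfl
    rfl

lemma totalDeg_zero (α : List ι) : totalDeg (0 : ι → ℤ) α = 0 := by
  induction α with
  | nil => rfl
  | cons a α ih => simp [ih]

lemma mul_toForm (f g : ShuffleAlgebra K ι) :
    Form.mul 0 (toForm f) (toForm g) = toForm (f * g) := by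
  funext α β
  rw [Form.mul_apply, shSum_symExp_zero]
  by_cases h : β = []
  · subst h
    rw [toForm_nil, mul_apply]
    simp only [shSum_nil, toForm_nil, totalDeg_zero, mul_zero, add_zero, sgn_zero, one_mul]
  · rw [toForm_of_ne _ _ h]
    refine shSum_eq_zero _ _ _ fun s t n => ?_
    rw [shSum_of_left_nil]
    · simp [toForm_of_ne _ _ h]
    · intro u v k hu
      simp [toForm_of_ne _ _ hu]

lemma partialT_toForm (a : ι) (f : ShuffleAlgebra K ι) :
    partialT a (toForm f) = toForm (partialDeriv a f) := rfl

lemma gradedComm_zero (P Q : Form K ι → Form K ι) (f : Form K ι) :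
    gradedComm 0 0 P Q f = P (Q f) - Q (P f) := by
  simp [gradedComm]

lemma vfAct_toForm [Fintype ι] (X : ι → ShuffleAlgebra K ι) (f : ShuffleAlgebra K ι) :
    vfAct 0 (fun a => toForm (X a)) (toForm f) = toForm (derivAlong partialDeriv X f) := by
  funext α β
  simp only [vfAct, partialT_toForm, mul_toForm, toForm_sum, derivAlong_apply]

lemma vfBracket_toForm [Fintype ι] (X Y : ι → ShuffleAlgebra K ι) :
    vfBracket 0 0 0 (fun a => toForm (X a)) (fun a => toForm (Y a)) =
      fun c => toForm (compBracket partialDeriv X Y c) := by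
  funext c
  rw [vfBracket, gradedComm_zero, vfAct_coord, vfAct_coord, vfAct_toForm, vfAct_toForm,
    compBracket, toForm_sub]

/-- The matrix of an endomorphism of the tangent bundle. -/
def matrixOf (J : VForm K ι) (c a : ι) : ShuffleAlgebra K ι := fun α => J c α [a]

lemma partialDt_eq_toForm {J : VForm K ι} (hJ : ∀ c α β, β.length ≠ 1 → J c α β = 0) (c a : ι) :
    partialDt 0 a (J c) = toForm (matrixOf J c a) := by
  funext α β
  by_cases h : β = []
  · subst h
    simp [partialDt, totalDeg_zero, toForm_nil, matrixOf]
  · rw [toForm_of_ne _ _ h, partialDt, hJ, mul_zero]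
    simpa using h

lemma applyEnd_toForm [Fintype ι] {J : VForm K ι} (hJ : ∀ c α β, β.length ≠ 1 → J c α β = 0)
    (X : ι → ShuffleAlgebra K ι) :
    applyEnd 0 J (fun a => toForm (X a)) = fun c => toForm (compApply (matrixOf J) X c) := by
  funext c α β
  simp only [applyEnd, insertion, partialDt_eq_toForm hJ, mul_toForm, toForm_sum, compApply]

lemma nijenhuis_toForm [Fintype ι] {J : VForm K ι} (hJ : ∀ c α β, β.length ≠ 1 → J c α β = 0)
    (X Y : ι → ShuffleAlgebra K ι) :
    nijenhuis 0 J (fun a => toForm (X a)) (fun a => toForm (Y a)) = fun c => toForm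
      (∑ i, ∑ j, X i * Y j * nijenhuisCoeff partialDeriv (matrixOf J) c i j) := by
  funext c
  rw [← nijenhuis_eq_sum]
  simp only [nijenhuis, applyEnd_toForm hJ, vfBracket_toForm, Pi.add_apply, Pi.sub_apply,
    toForm_add, toForm_sub]

/-- The part of degree zero of a form. -/
def ofForm (f : Form K ι) : ShuffleAlgebra K ι := fun α => f α []

lemma eq_toForm_of_isFunction {f : Form K ι} (hf : IsFunction 0 f) : f = toForm (ofForm f) := by
  funext α β
  by_cases h : β = []
  · subst h
    rw [toForm_nil, ofForm]
  · rw [toForm_of_ne _ _ h, hf.1 _ _ h]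

open Classical in
lemma isFunction_toForm_ite (i a : ι) :
    IsFunction 0 (toForm (if a = i then (1 : ShuffleAlgebra K ι) else 0)) := by
  refine ⟨fun α β h => toForm_of_ne _ _ h, fun α α' x y => ?_⟩
  split_ifs <;> simp [toForm_nil, one_apply, zero_apply]

/-- By tensoriality, the constant fields `∂/∂t^i` and `∂/∂t^j` already extract each coefficient. -/
lemma nijenhuis_eq_zero_iff [Fintype ι] {J : VForm K ι}
    (hJ : ∀ c α β, β.length ≠ 1 → J c α β = 0) :
    (∀ X Y : VForm K ι, (∀ a, IsFunction 0 (X a)) → (∀ a, IsFunction 0 (Y a)) →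
      nijenhuis 0 J X Y = 0) ↔
    ∀ c i j, nijenhuisCoeff partialDeriv (matrixOf J) c i j = 0 := by
  classical
  constructor
  · intro h c i j
    have := congrFun (h _ _ (isFunction_toForm_ite i) (isFunction_toForm_ite j)) c
    rw [nijenhuis_toForm hJ, Pi.zero_apply, ← toForm_zero] at this
    simpa using toForm_injective this
  · intro h X Y hX hY
    have hX' : X = fun a => toForm (ofForm (X a)) :=
      funext fun a => eq_toForm_of_isFunction (hX a)
    have hY' : Y = fun a => toForm (ofForm (Y a)) :=
      funext fun a => eq_toForm_of_isFunction (hY a)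
    rw [hX', hY', nijenhuis_toForm hJ]
    funext c
    simp [h, toForm_zero]

lemma sum_apply {I : Type*} (S : Finset I) (f : I → ShuffleAlgebra K ι) (α : List ι) :
    (∑ a ∈ S, f a) α = ∑ a ∈ S, f a α :=
  map_sum (⟨⟨fun g => g α, rfl⟩, fun _ _ => rfl⟩ : ShuffleAlgebra K ι →+ K) f S

lemma mul_sub_mul_apply (f g f' g' : ShuffleAlgebra K ι) (α : List ι) :
    (f * g - f' * g') α =
      shSum (fun _ _ => 0) α fun s t _ => f s * g t - f' s * g' t := by
  rw [sub_eq_add_neg, ← neg_mul, add_apply, mul_apply, mul_apply, ← shSum_add]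
  congr 1
  funext s t n
  change _ + -f' s * _ = _
  ring

/-- Both factors are one-forms, so only the splittings of `[i, j]` into single letters count, and
the two orders have opposite signs. -/
lemma vfAct_pair {J : VForm K ι} [Fintype ι] (hJ : ∀ c α β, β.length ≠ 1 → J c α β = 0)
    (c i j : ι) (α : List ι) : vfAct 0 J (J c) α [i, j] =
      (∑ a, (matrixOf J a i * partialDeriv a (matrixOf J c j) -
        matrixOf J a j * partialDeriv a (matrixOf J c i))) α := by
  have h0 : ∀ c s, J c s [] = 0 := fun c s => hJ _ _ _ (by simp)
  have h2 : ∀ c s i j, J c s [i, j] = 0 := fun c s i j => hJ _ _ _ (by simp)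
  rw [vfAct, finsum_eq_sum_of_fintype, sum_apply]
  refine Finset.sum_congr rfl fun a _ => ?_
  rw [Form.mul_apply, shSum_symExp_zero, mul_sub_mul_apply]
  congr 1
  funext s t n
  simp [shSum_cons, h0, h2, partialT, symExp, dtDeg, totalDeg_zero, matrixOf, partialDeriv_apply]
  ring

/-- The two-form `dJ^a` takes both letters, and `∂J^c/∂(dt^a)` is a function. -/
lemma insertionD_pair {J : VForm K ι} [Fintype ι] (hJ : ∀ c α β, β.length ≠ 1 → J c α β = 0)
    (c i j : ι) (α : List ι) : insertionD 0 J (J c) α [i, j] =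
      (∑ a, (partialDeriv i (matrixOf J a j) - partialDeriv j (matrixOf J a i)) *
        matrixOf J c a) α := by
  have h0 : ∀ c s, J c s [] = 0 := fun c s => hJ _ _ _ (by simp)
  have h1 : ∀ c s i, deRham 0 (J c) s [i] = 0 := by
    intro c s i
    simp [deRham_cons, deRham_nil, h0]
  have h2 : ∀ c s i j, deRham 0 (J c) s [i, j] = J c (i :: s) [j] - J c (j :: s) [i] := by
    intro c s i j
    simp [deRham_cons, deRham_nil, partialDt, dtDeg, totalDeg_zero]
    ring
  rw [insertionD, insertion, finsum_eq_sum_of_fintype, sum_apply]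
  refine Finset.sum_congr rfl fun a _ => ?_
  rw [Form.mul_apply, shSum_symExp_zero, sub_mul, mul_sub_mul_apply]
  congr 1
  funext s t n
  simp [shSum_cons, deRham_nil, h1, h2, partialDt, dtDeg, totalDeg_zero, matrixOf,
    partialDeriv_apply]
  ring

lemma shSum_eq_zero_of_length {X M : Type*} [AddCommMonoid M] (e : X → X → ℤ) (l : List X)
    (F : List X → List X → ℤ → M) (h : ∀ s t n, l.length = s.length + t.length → F s t n = 0) :
    shSum e l F = 0 := by
  rw [← shSum_eq_zero e l (fun _ _ _ => (0 : M)) fun _ _ _ => rfl]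
  refine shSum_congr_of_rel (fun l s t _ _ => l.length = s.length + t.length) rfl ?_ ?_ l _ _
    fun s t n _ hl => h s t n hl
  · intro a l s t n n' hl
    simp only [List.length_cons, hl]
    omega
  · intro a l s t n n' hl
    simp only [List.length_cons, hl]
    omega

lemma lieDerivation_of_length_ne_two {J : VForm K ι}
    (hJ : ∀ c α β, β.length ≠ 1 → J c α β = 0) (c : ι) (α : List ι) {β : List ι}
    (hβ : β.length ≠ 2) : vfAct 0 J (J c) α β = 0 ∧ insertionD 0 J (J c) α β = 0 := by
  have hd : ∀ a s (u : List ι), u.length ≠ 2 → deRham 0 (J a) s u = 0 := by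
    intro a s u hu
    rw [deRham_eq_shSum]
    refine shSum_eq_zero_of_length _ _ _ fun q q' k hl => ?_
    split_ifs with hq
    · rw [hJ _ _ q' (by omega), mul_zero]
    · rfl
  constructor
  · refine finsum_eq_zero_of_forall_eq_zero fun a => ?_
    rw [Form.mul_apply]
    refine shSum_eq_zero _ _ _ fun s t n => shSum_eq_zero_of_length _ _ _ fun u v k hl => ?_
    by_cases hu : u.length = 1
    · rw [partialT, hJ c _ v (by omega), mul_zero, mul_zero]
    · rw [hJ a _ u hu, zero_mul, mul_zero]
  · refine finsum_eq_zero_of_forall_eq_zero fun a => ?_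
    rw [Form.mul_apply]
    refine shSum_eq_zero _ _ _ fun s t n => shSum_eq_zero_of_length _ _ _ fun u v k hl => ?_
    by_cases hu : u.length = 2
    · rw [partialDt, hJ c _ (a :: v) (by rw [List.length_cons]; omega), mul_zero, mul_zero,
        mul_zero]
    · beta_reduce
      rw [hd a _ u hu, zero_mul, mul_zero]

/-- For a one-form `J` the components of the bracket are two-forms, so the coefficients at words
`[i, j]` decide; these are twice the Nijenhuis coefficients. -/
lemma fnBracket_eq_zero_iff [CharZero K] [Fintype ι] {J : VForm K ι} (hJ1 : IsDegOne 0 J)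
    (hJ : ∀ c α β, β.length ≠ 1 → J c α β = 0) :
    fnBracket 0 1 1 J J = 0 ↔ ∀ c i j, nijenhuisCoeff partialDeriv (matrixOf J) c i j = 0 := by
  have hfn : ∀ c, fnBracket 0 1 1 J J c = (2 : K) • (vfAct 0 J (J c) - insertionD 0 J (J c)) := by
    intro c
    simp only [fnBracket, gradedComm, hJ1.lieDerivation_coord, hJ1.lieDerivation_apply (J c),
      mul_one, sgn_one, neg_smul, one_smul, sub_neg_eq_add, two_smul]
  have hpair : ∀ c i j α, (vfAct 0 J (J c) - insertionD 0 J (J c)) α [i, j] =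
      nijenhuisCoeff partialDeriv (matrixOf J) c i j α := by
    intro c i j α
    rw [Pi.sub_apply, Pi.sub_apply, vfAct_pair hJ, insertionD_pair hJ]
    rfl
  constructor
  · intro h c i j
    funext α
    have h' := congrFun h c
    rw [hfn, Pi.zero_apply, smul_eq_zero] at h'
    rw [← hpair, h'.resolve_left two_ne_zero]
    rfl
  · intro h
    funext c
    rw [hfn]
    suffices vfAct 0 J (J c) - insertionD 0 J (J c) = 0 by rw [this, smul_zero]; rfl
    funext α β
    by_cases hβ : β.length = 2
    · obtain ⟨i, j, rfl⟩ := List.length_eq_two.1 hβ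
      rw [hpair, h]
      rfl
    · obtain ⟨h1, h2⟩ := lieDerivation_of_length_ne_two hJ c α hβ
      rw [Pi.sub_apply, Pi.sub_apply, h1, h2, sub_zero]
      rfl

end ShuffleAlgebra

end ShuffleAlgebra

/-! ### Vector spaces concentrated in degree zero -/

section DegreeZero

variable {K V ι : Type*} [Field K] [AddCommGroup V] [Module K V] {𝒱 : ℤ → Submodule K V}
  {b : Module.Basis ι K V} {m : Operations 𝒱}

lemma eq_zero_of_concentrated {deg : ι → ℤ} (hb : ∀ a, b a ∈ 𝒱 (deg a))
    (h : ∀ n : ℤ, n ≠ 0 → 𝒱 n = ⊥) : deg = 0 := by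
  funext a
  by_contra hne
  have := hb a
  rw [h _ hne, Submodule.mem_bot] at this
  exact b.ne_zero a this

/-- For a nonzero coefficient the degree relation reads `0 = 1 - p`. -/
lemma totalForm_eq_zero [DirectSum.Decomposition 𝒱] (hb : ∀ a, b a ∈ 𝒱 ((0 : ι → ℤ) a)) (c : ι)
    (α : List ι) {β : List ι} (hβ : β.length ≠ 1) : totalForm 0 b m c α β = 0 := by
  by_cases h : b.repr (evalOp m.μ (α.map b) (β.map b)) c = 0
  · rw [totalForm, h, mul_zero]
  · have := deg_eq_of_repr_ne_zero hb h
    rw [ShuffleAlgebra.totalDeg_zero, ShuffleAlgebra.totalDeg_zero, Pi.zero_apply] at this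
    omega

lemma eth_eq_zero [DirectSum.Decomposition 𝒱] (hb : ∀ a, b a ∈ 𝒱 ((0 : ι → ℤ) a)) :
    eth 0 b m = 0 := by
  funext c α β
  rw [eth_apply]
  split_ifs with h
  · subst h
    exact totalForm_eq_zero hb c α (by simp)
  · rfl

lemma gamma_eq_gammaP_one [DirectSum.Decomposition 𝒱] (hb : ∀ a, b a ∈ 𝒱 ((0 : ι → ℤ) a)) :
    gamma 0 b m = gammaP 0 b m 1 := by
  funext c α β
  rw [gamma_apply, gammaP_eq]
  by_cases h : β.length = 1
  · rw [if_pos h, if_neg (by rintro rfl; simp at h)]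
  · rw [totalForm_eq_zero hb c α h]
    simp

lemma vfAct_zero (deg : ι → ℤ) (f : Form K ι) : vfAct deg 0 f = 0 := by
  funext α β
  simp [vfAct]

lemma lieDerivative_zero (deg : ι → ℤ) (L : VForm K ι) : lieDerivative deg 1 1 0 L = 0 := by
  have hi : ∀ f : Form K ι, insertion deg 0 f = 0 := by
    intro f
    funext α β
    simp [insertion]
  have hi' : ∀ L : VForm K ι, insertion deg L 0 = 0 := by
    intro L
    have h : ∀ a, partialDt deg a (0 : Form K ι) = 0 := by
      intro a
      funext α β
      simp [partialDt]
    funext α β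
    simp [insertion, h]
  funext c
  simp [lieDerivative, gradedComm, lieDerivation, hi, hi']

lemma isPreLieSqInfinity_iff_fnBracket [CharZero K] [DirectSum.Decomposition 𝒱]
    (hb : ∀ a, b a ∈ 𝒱 ((0 : ι → ℤ) a)) :
    m.IsPreLieSqInfinity ↔ fnBracket 0 1 1 (gammaP 0 b m 1) (gammaP 0 b m 1) = 0 := by
  have hbr : vfBracket (K := K) (0 : ι → ℤ) 1 1 0 0 = 0 := by
    funext c
    simp [vfBracket, gradedComm, vfAct_zero]
  rw [structure_equations_iff_isPreLieSqInfinity hb, eth_eq_zero hb, gamma_eq_gammaP_one hb,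
    lieDerivative_zero, zero_add, smul_eq_zero]
  simp [hbr]

end DegreeZero

end PreLieSq

theorem proposition3p7p1 {K V ι : Type*} [Field K] [CharZero K] [AddCommGroup V] [Module K V]
    (𝒱 : ℤ → Submodule K V) [DirectSum.Decomposition 𝒱]
    (b : Module.Basis ι K V) (deg : ι → ℤ) (hb : ∀ a, b a ∈ 𝒱 (deg a))
    (m : PreLieSq.Operations 𝒱) :
    (m.IsPreLieSqInfinity ↔
      PreLieSq.vfBracket deg 1 1 (PreLieSq.eth deg b m) (PreLieSq.eth deg b m) = 0 ∧
      PreLieSq.lieDerivative deg 1 1 (PreLieSq.eth deg b m) (PreLieSq.gamma deg b m)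
        + (1 / 2 : K) •
          PreLieSq.fnBracket deg 1 1 (PreLieSq.gamma deg b m) (PreLieSq.gamma deg b m) = 0) ∧
    ((∀ n : ℤ, n ≠ 0 → 𝒱 n = ⊥) →
      PreLieSq.eth deg b m = 0 ∧
      PreLieSq.gamma deg b m = PreLieSq.gammaP deg b m 1 ∧
      (m.IsPreLieSqInfinity ↔
        PreLieSq.fnBracket deg 1 1 (PreLieSq.gammaP deg b m 1) (PreLieSq.gammaP deg b m 1) = 0) ∧
      (FiniteDimensional K V →
        (m.IsPreLieSqInfinity ↔
          ∀ X Y : PreLieSq.VForm K ι,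
            (∀ a, PreLieSq.IsFunction deg (X a)) → (∀ a, PreLieSq.IsFunction deg (Y a)) →
              PreLieSq.nijenhuis deg (PreLieSq.gammaP deg b m 1) X Y = 0))) := by
  refine ⟨PreLieSq.structure_equations_iff_isPreLieSqInfinity hb, fun h => ?_⟩
  obtain rfl := PreLieSq.eq_zero_of_concentrated hb h
  refine ⟨PreLieSq.eth_eq_zero hb, PreLieSq.gamma_eq_gammaP_one hb,
    PreLieSq.isPreLieSqInfinity_iff_fnBracket hb, fun hfin => ?_⟩
  -- Finite dimension makes the index set of the basis finite, so that contractions are finite sums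
  -- in the ring of formal functions.
  have : Finite ι := Module.Finite.finite_basis b
  have := Fintype.ofFinite ι
  have hJ : ∀ c α β, β.length ≠ 1 → PreLieSq.gammaP 0 b m 1 c α β = 0 := fun c α β hβ => by
    rw [PreLieSq.gammaP_eq, if_neg hβ]
  have hJ1 : PreLieSq.IsDegOne 0 (PreLieSq.gammaP 0 b m 1) := by
    rw [← PreLieSq.gamma_eq_gammaP_one hb]
    exact PreLieSq.isDegOne_gamma hb
  rw [PreLieSq.isPreLieSqInfinity_iff_fnBracket hb,
    PreLieSq.ShuffleAlgebra.fnBracket_eq_zero_iff hJ1 hJ,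
    PreLieSq.ShuffleAlgebra.nijenhuis_eq_zero_iff hJ]
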